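/- Let $(\Omega,\mathcal F,P)$ be a probability space. For $\sigma$-fields $\mathcal A,\mathcal B\subset\mathcal F$ let $$\rho(\mathcal A,\mathcal B)=\sup|\mathrm{Corr}(f,g)|,$$ the supremum over all square-integrable real random variables $f,g$ with $f$ $\mathcal A$-measurable and $g$ $\mathcal B$-measurable (with $\mathrm{Corr}(f,g)=0$ if $f$ or $g$ is a.s. constant). For a sequence $X=(X_k,\,k\in\mathbb Z)$ of random variables and $n\ge 1$ let $$\rho^*(X,n)=\sup\rho\bigl(\sigma(X_k,\,k\in S),\,\sigma(X_k,\,k\in T)\bigr),$$ the supremum over all nonempty disjoint sets $S,T\subset\mathbb Z$ with $\min_{s\in S,\,t\in T}|s-t|\ge n$. The sequence $X$ is called $\rho^*$-mixing (interlaced $\rho$-mixing) if $\rho^*(X,n)\to0$ as $n\to\infty$. An ordered triplet $(\mathcal A,\mathcal B,\mathcal C)$ of $\sigma$-fields is a Markov triplet if $P(C\mid\mathcal A\vee\mathcal B)=P(C\mid\mathcal B)$ a.s. for every $C\in\mathcal C$. For $a\in(0,1)$ and $\lambda>0$, a strictly stationary INAR(1) process with Poisson innovations (with parameters $a$ and $\lambda$)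 is a strictly stationary Markov chain $X=(X_k,\,k\in\mathbb Z)$ with state space $\{0,1,2,\dots\}$ for which there exist random variables $U_k,V_k$ ($k\in\mathbb Z$) with values in $\{0,1,2,\dots\}$ such that for each $k\in\mathbb Z$: 1. $X_k=U_k+V_k$ a.s.; 2. for each integer $x\ge0$, the conditional distribution of $U_k$ given $\{X_{k-1}=x\}$ is binomial with parameters $x$ and $a$; 3. $\bigl(\sigma(U_j,V_j,X_j,\ j\le k-1),\ \sigma(X_{k-1}),\ \sigma(U_k)\bigr)$ is a Markov triplet; 4. $V_k$ has the Poisson distribution with mean $\lambda$; 5. $V_k$ is independent of $\sigma(U_j,V_j,X_j,\ j\le k-1)\vee\sigma(U_k)$. **Theorem 1.3.** For every $b\in(0,1)$ there exist constants $C>0$ and $r\in(0,1)$, depending only on $b$, such that for all $a\in(0,b]$ and $\lambda>0$, every strictly stationary INAR(1) process $X$ with Poisson innovations with parameters $a$ and $\lambda$ is $\rho^*$-mixing, and $$\rho^*(X,n)\le C\,r^n\qquad\text{for all } n\ge1.$$ In particular, the exponential bound for a given $a$ does not depend on $\lambda$. -/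

import Mathlib

open MeasureTheory ProbabilityTheory Filter Topology
open scoped NNReal ENNReal

noncomputable section

namespace INARMixing

variable {Ω : Type*}

/-- The `σ`-field `σ(Z_k, k ∈ S)` generated by the `ℕ`-valued random variables `Z k`, `k ∈ S`
(for `ℕ` with its discrete `σ`-field). -/
@[reducible] def sigmaGen (Z : ℤ → Ω → ℕ) (S : Set ℤ) : MeasurableSpace Ω :=
  ⨆ k ∈ S, MeasurableSpace.comap (Z k) ⊤

/-- The correlation `Corr(f, g)` of two square-integrable real random variables. If one of the two
variances vanishes, the quotient is `0`, the usual convention. -/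
def corr {mΩ : MeasurableSpace Ω} (P : Measure Ω) (f g : Ω → ℝ) : ℝ :=
  covariance f g P / (√(variance f P) * √(variance g P))

/-- The maximal correlation `ρ(𝓐, 𝓑) = sup |Corr(f, g)|`, the supremum over all square-integrable
`f`, `g` such that `f` is `𝓐`-measurable and `g` is `𝓑`-measurable. (The set is nonempty, and it is
bounded by `1` for a probability measure `P`.) -/
def maxCorr (𝓐 𝓑 : MeasurableSpace Ω) {mΩ : MeasurableSpace Ω} (P : Measure Ω) : ℝ :=
  sSup {r : ℝ | ∃ f g : Ω → ℝ, Measurable[𝓐] f ∧ MemLp f 2 P ∧ Measurable[𝓑] g ∧ MemLp g 2 P ∧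
    r = |corr P f g|}

/-- The dependence coefficient `ρ*(X, n)`: the supremum of `ρ(σ(X_k, k ∈ S), σ(X_k, k ∈ T))` over
all nonempty disjoint `S, T ⊆ ℤ` with `dist(S, T) = min |s - t| ≥ n`. -/
def rhoStar {mΩ : MeasurableSpace Ω} (P : Measure Ω) (X : ℤ → Ω → ℕ) (n : ℕ) : ℝ :=
  sSup {r : ℝ | ∃ S T : Set ℤ, S.Nonempty ∧ T.Nonempty ∧ Disjoint S T ∧
    (∀ s ∈ S, ∀ t ∈ T, (n : ℤ) ≤ |s - t|) ∧ r = maxCorr (sigmaGen X S) (sigmaGen X T) P}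

/-- `X` is `ρ*`-mixing (interlaced `ρ`-mixing): `ρ*(X, n) → 0` as `n → ∞`. -/
def IsRhoStarMixing {mΩ : MeasurableSpace Ω} (P : Measure Ω) (X : ℤ → Ω → ℕ) : Prop :=
  Tendsto (fun n : ℕ => rhoStar P X n) atTop (𝓝 0)

/-- `(𝓐, 𝓑, 𝓒)` is a Markov triplet: `P(C | 𝓐 ∨ 𝓑) = P(C | 𝓑)` a.s. for all `C ∈ 𝓒`. -/
def IsMarkovTriplet (𝓐 𝓑 𝓒 : MeasurableSpace Ω) {mΩ : MeasurableSpace Ω} (P : Measure Ω) : Prop :=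
  ∀ C : Set Ω, MeasurableSet[𝓒] C →
    condExp (𝓐 ⊔ 𝓑) P (C.indicator fun _ => (1 : ℝ)) =ᵐ[P]
      condExp 𝓑 P (C.indicator fun _ => (1 : ℝ))

/-- Strict stationarity: all shifts of the sequence have the same law on `ℕ^ℤ`. -/
def IsStrictlyStationary {mΩ : MeasurableSpace Ω} (P : Measure Ω) (X : ℤ → Ω → ℕ) : Prop :=
  ∀ h : ℤ, P.map (fun ω (k : ℤ) => X (k + h) ω) = P.map (fun ω (k : ℤ) => X k ω)

/-- The Markov property: given `X_{k-1}`, the past `(X_j, j ≤ k - 1)` carries no further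
information on `X_k`. -/
def IsMarkovChain {mΩ : MeasurableSpace Ω} (P : Measure Ω) (X : ℤ → Ω → ℕ) : Prop :=
  ∀ k : ℤ, IsMarkovTriplet (sigmaGen X (Set.Iic (k - 1))) (sigmaGen X {k - 1})
    (sigmaGen X {k}) P

/-- The `σ`-field `σ(U_j, V_j, X_j, j ≤ k - 1)`. -/
@[reducible] def pastSigma (U V X : ℤ → Ω → ℕ) (k : ℤ) : MeasurableSpace Ω :=
  sigmaGen U (Set.Iic (k - 1)) ⊔ sigmaGen V (Set.Iic (k - 1)) ⊔ sigmaGen X (Set.Iic (k - 1))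

/-- The structural properties of an INAR(1) process `X` with Poisson (`lam`) innovations `V` and
thinned part `U`. -/
structure IsPoissonINARDecomposition (a : unitInterval) (lam : ℝ≥0) {mΩ : MeasurableSpace Ω}
    (P : Measure Ω) (X U V : ℤ → Ω → ℕ) : Prop where
  measurable_U : ∀ k, Measurable (U k)
  measurable_V : ∀ k, Measurable (V k)
  eq_add : ∀ k, ∀ᵐ ω ∂P, X k ω = U k ω + V k ω
  /-- given `X_{k-1} = x`, the variable `U_k` is binomial with parameters `x` and `a` -/
  binomial_U : ∀ (k : ℤ) (x : ℕ), P (X (k - 1) ⁻¹' {x}) ≠ 0 →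
    (cond P (X (k - 1) ⁻¹' {x})).map (U k) = binomial x a
  markov_U : ∀ k, IsMarkovTriplet (pastSigma U V X k) (sigmaGen X {k - 1}) (sigmaGen U {k}) P
  poisson_V : ∀ k, P.map (V k) = poissonMeasure lam
  indep_V : ∀ k, Indep (sigmaGen V {k}) (pastSigma U V X k ⊔ sigmaGen U {k}) P

/-- `X = (X_k, k ∈ ℤ)` is a strictly stationary INAR(1) process (a strictly stationary Markov chain
with state space `{0, 1, 2, …}`) with Poisson innovations of mean `lam` and thinning
parameter `a`. -/
structure IsStationaryPoissonINAR (a : unitInterval) (lam : ℝ≥0) {mΩ : MeasurableSpace Ω}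
    (P : Measure Ω) (X : ℤ → Ω → ℕ) : Prop where
  measurable_X : ∀ k, Measurable (X k)
  stationary : IsStrictlyStationary P X
  markov : IsMarkovChain P X
  exists_decomposition : ∃ U V : ℤ → Ω → ℕ, IsPoissonINARDecomposition a lam P X U V

end INARMixing

end

/-!
The process is a superposition of particles, each of which is alive during a random interval of
time. On a window `{0, …, M}` the numbers of particles alive exactly on `[i, j]` behave like
independent Poisson variables with means `lam * birthWeight a i * deathWeight a M j`
(`particleWeight`); this is read off from the joint generating function, which is computed by
recursion over the window (`integral_prod_pow`, `windowExponent_eq_sum_particleWeight`). No such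
particles have to be constructed on the given probability space.

Two reductions lead from the process to a single particle. A Poisson superposition is the limit in
law of a sum of `m` independent rare particles (`tendsto_wmean_sum_rare`, from Lévy's convergence
theorem), and by the Csáki–Fisher theorem (`MaxCorrLE.prod`, `MaxCorrLE.pi`) the maximal
correlation of a sum of independent copies does not exceed that of one copy. As the particle gets
rarer, its maximal correlation tends to the uncentred correlation under the intensity, for
functions which vanish if no particle is seen (`maxCorrLE_rareWeight`). The intensity `lam` cancels
there, which is why the bound does not depend on it.

For a single particle, the trace of `[i, j]` on `S` is determined by the first point of `S` after
`i` and the last point of `S` before `j`. Since `particleWeight` is a product of a function of `i`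
and a function of `j`, the Schur test applies to the two end points separately
(`abs_sum_particleWeight_le`). For sets `S` and `T` at distance at least `n` each end point
contributes a factor of order `√a ^ n`, however interlaced `S` and `T` are.

Square-integrable functions of infinitely many coordinates are reached by truncation and by
martingale convergence (`corrLE_of_bounded`, `corrLE_of_memLp`).
-/

open MeasureTheory ProbabilityTheory Filter Topology
open scoped NNReal ENNReal

namespace INARMixing

/-! ### Maximal correlation on finite weighted sets -/

section Finite

variable {Y Y₁ Y₂ α α₁ α₂ β β₁ β₂ : Type*} [Fintype Y] [Fintype Y₁] [Fintype Y₂]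

/-- The expectation of `h` with respect to the weights `p` on a finite set. -/
def wmean (p h : Y → ℝ) : ℝ := ∑ y, p y * h y

/-- The covariance of `f` and `g` with respect to the weights `p` (which are meant to have
total mass `1`). -/
def wcov (p f g : Y → ℝ) : ℝ := wmean p (fun y => f y * g y) - wmean p f * wmean p g

/-- The maximal correlation of the finite random elements `A` and `B` is at most `ρ`. The
inequality is written without a quotient, so that variances may vanish. -/
def MaxCorrLE (p : Y → ℝ) (A : Y → α) (B : Y → β) (ρ : ℝ) : Prop :=
  ∀ (f : α → ℝ) (g : β → ℝ), |wcov p (f ∘ A) (g ∘ B)| ≤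
    ρ * (√(wcov p (f ∘ A) (f ∘ A)) * √(wcov p (g ∘ B) (g ∘ B)))

lemma wcov_self_nonneg {p : Y → ℝ} (hp : ∀ y, 0 ≤ p y) (h1 : ∑ y, p y = 1) (f : Y → ℝ) :
    0 ≤ wcov p f f := by
  have : wcov p f f = ∑ y, p y * (f y - wmean p f) ^ 2 := by
    have e : ∀ y, p y * (f y - wmean p f) ^ 2 =
        p y * (f y * f y) - 2 * wmean p f * (p y * f y) + wmean p f ^ 2 * p y := fun y => by ring
    simp_rw [e]
    rw [Finset.sum_add_distrib, Finset.sum_sub_distrib, ← Finset.mul_sum, ← Finset.mul_sum, h1]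
    change wmean p (fun y => f y * f y) - wmean p f * wmean p f =
      wmean p (fun y => f y * f y) - 2 * wmean p f * wmean p f + wmean p f ^ 2 * 1
    ring
  rw [this]
  exact Finset.sum_nonneg fun y _ => mul_nonneg (hp y) (sq_nonneg _)

lemma wcov_sub_const {p : Y → ℝ} (h1 : ∑ y, p y = 1) (f g : Y → ℝ) (c d : ℝ) :
    wcov p (fun y => f y - c) (fun y => g y - d) = wcov p f g := by
  have ef : wmean p (fun y => f y - c) = wmean p f - c := by
    simp [wmean, mul_sub, Finset.sum_sub_distrib, ← Finset.sum_mul, h1]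
  have eg : wmean p (fun y => g y - d) = wmean p g - d := by
    simp [wmean, mul_sub, Finset.sum_sub_distrib, ← Finset.sum_mul, h1]
  have efg : wmean p (fun y => (f y - c) * (g y - d)) =
      wmean p (fun y => f y * g y) - d * wmean p f - c * wmean p g + c * d := by
    have e : ∀ y, p y * ((f y - c) * (g y - d)) =
        p y * (f y * g y) - d * (p y * f y) - c * (p y * g y) + c * d * p y := fun y => by ring
    simp only [wmean, e]
    rw [Finset.sum_add_distrib, Finset.sum_sub_distrib, Finset.sum_sub_distrib, ← Finset.mul_sum,
      ← Finset.mul_sum, ← Finset.mul_sum, h1, mul_one]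
  rw [wcov, wcov, ef, eg, efg]
  ring

/-- The weighted Cauchy–Schwarz inequality, for products of square roots. -/
lemma sum_mul_sqrt_mul_sqrt_le {p v w : Y → ℝ} (hp : ∀ y, 0 ≤ p y) (hv : ∀ y, 0 ≤ v y)
    (hw : ∀ y, 0 ≤ w y) :
    ∑ y, p y * (√(v y) * √(w y)) ≤ √(∑ y, p y * v y) * √(∑ y, p y * w y) := by
  have := Real.sum_sqrt_mul_sqrt_le (Finset.univ : Finset Y)
    (f := fun y => p y * v y) (g := fun y => p y * w y) (fun y => mul_nonneg (hp y) (hv y))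
    (fun y => mul_nonneg (hp y) (hw y))
  refine le_trans (le_of_eq (Finset.sum_congr rfl fun y _ => ?_)) this
  rw [Real.sqrt_mul (hp y), Real.sqrt_mul (hp y), mul_mul_mul_comm, Real.mul_self_sqrt (hp y)]

lemma sum_mul_abs_le {p v w : Y → ℝ} (hp : ∀ y, 0 ≤ p y) :
    ∑ y, p y * (|v y| * |w y|) ≤ √(∑ y, p y * v y ^ 2) * √(∑ y, p y * w y ^ 2) := by
  simpa [Real.sqrt_sq_eq_abs] using sum_mul_sqrt_mul_sqrt_le (v := fun y => v y ^ 2)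
    (w := fun y => w y ^ 2) hp (fun y => sq_nonneg _) (fun y => sq_nonneg _)

lemma sqrt_mul_sqrt_add_le {x y a b : ℝ} (hx : 0 ≤ x) (hy : 0 ≤ y) (ha : 0 ≤ a) (hb : 0 ≤ b) :
    √x * √y + √a * √b ≤ √(x + a) * √(y + b) := by
  have := sum_mul_sqrt_mul_sqrt_le (Y := Bool) (p := fun _ => 1) (v := fun t => cond t x a)
    (w := fun t => cond t y b) (fun _ => zero_le_one) (by simp [hx, ha]) (by simp [hy, hb])
  simpa using this

/-- The law of total covariance for a product of two finite probability spaces. -/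
lemma wcov_prod (p₁ : Y₁ → ℝ) (p₂ : Y₂ → ℝ) (F G : Y₁ × Y₂ → ℝ) :
    wcov (fun y : Y₁ × Y₂ => p₁ y.1 * p₂ y.2) F G =
      wmean p₁ (fun y => wcov p₂ (fun z => F (y, z)) (fun z => G (y, z))) +
        wcov p₁ (fun y => wmean p₂ fun z => F (y, z)) (fun y => wmean p₂ fun z => G (y, z)) := by
  have e : ∀ H : Y₁ × Y₂ → ℝ, wmean (fun y : Y₁ × Y₂ => p₁ y.1 * p₂ y.2) H =
      wmean p₁ (fun y => wmean p₂ fun z => H (y, z)) := fun H => by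
    simp [wmean, Fintype.sum_prod_type, Finset.mul_sum, mul_assoc]
  simp only [wcov, e]
  rw [← sub_eq_zero]
  simp only [wmean, mul_sub, Finset.sum_sub_distrib]
  ring

/-- The Csáki–Fisher theorem for two independent pairs: the maximal correlation of
`(A₁, A₂)` and `(B₁, B₂)` does not exceed the larger of the two maximal correlations. It follows
by conditioning on the first factor. -/
lemma MaxCorrLE.prod {p₁ : Y₁ → ℝ} {p₂ : Y₂ → ℝ} {A₁ : Y₁ → α₁} {B₁ : Y₁ → β₁} {A₂ : Y₂ → α₂}
    {B₂ : Y₂ → β₂} {ρ : ℝ} (hρ : 0 ≤ ρ) (hp₁ : ∀ y, 0 ≤ p₁ y) (hs₁ : ∑ y, p₁ y = 1)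
    (hp₂ : ∀ y, 0 ≤ p₂ y) (hs₂ : ∑ y, p₂ y = 1)
    (h₁ : MaxCorrLE p₁ A₁ B₁ ρ) (h₂ : MaxCorrLE p₂ A₂ B₂ ρ) :
    MaxCorrLE (fun y : Y₁ × Y₂ => p₁ y.1 * p₂ y.2) (Prod.map A₁ A₂) (Prod.map B₁ B₂) ρ := by
  intro f g
  rw [wcov_prod, wcov_prod p₁ p₂ (f ∘ _), wcov_prod p₁ p₂ (g ∘ _)]
  set V : Y₁ → ℝ := fun y => wcov p₂ (fun z => (f ∘ Prod.map A₁ A₂) (y, z))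
    (fun z => (f ∘ Prod.map A₁ A₂) (y, z))
  set W : Y₁ → ℝ := fun y => wcov p₂ (fun z => (g ∘ Prod.map B₁ B₂) (y, z))
    (fun z => (g ∘ Prod.map B₁ B₂) (y, z))
  have hV : ∀ y, 0 ≤ V y := fun y => wcov_self_nonneg hp₂ hs₂ _
  have hW : ∀ y, 0 ≤ W y := fun y => wcov_self_nonneg hp₂ hs₂ _
  have key₂ : |wmean p₁ (fun y => wcov p₂ (fun z => (f ∘ Prod.map A₁ A₂) (y, z))
      (fun z => (g ∘ Prod.map B₁ B₂) (y, z)))| ≤ ρ * (√(wmean p₁ V) * √(wmean p₁ W)) := by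
    calc _ ≤ ∑ y, p₁ y * (ρ * (√(V y) * √(W y))) := by
          refine (Finset.abs_sum_le_sum_abs _ _).trans (Finset.sum_le_sum fun y _ => ?_)
          rw [abs_mul, abs_of_nonneg (hp₁ y)]
          exact mul_le_mul_of_nonneg_left
            (h₂ (fun a => f (A₁ y, a)) (fun b => g (B₁ y, b))) (hp₁ y)
      _ = ρ * ∑ y, p₁ y * (√(V y) * √(W y)) := by
          rw [Finset.mul_sum]
          exact Finset.sum_congr rfl fun y _ => by ring
      _ ≤ _ := mul_le_mul_of_nonneg_left (sum_mul_sqrt_mul_sqrt_le hp₁ hV hW) hρ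
  have key₁ := h₁ (fun a => wmean p₂ fun z => f (a, A₂ z)) (fun b => wmean p₂ fun z => g (b, B₂ z))
  refine (abs_add_le _ _).trans ((add_le_add key₂ key₁).trans ?_)
  rw [← mul_add]
  exact mul_le_mul_of_nonneg_left (sqrt_mul_sqrt_add_le
    (Finset.sum_nonneg fun y _ => mul_nonneg (hp₁ y) (hV y))
    (Finset.sum_nonneg fun y _ => mul_nonneg (hp₁ y) (hW y))
    (wcov_self_nonneg hp₁ hs₁ _) (wcov_self_nonneg hp₁ hs₁ _)) hρ

lemma wcov_equiv (e : Y₁ ≃ Y₂) (p f g : Y₂ → ℝ) :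
    wcov (p ∘ e) (f ∘ e) (g ∘ e) = wcov p f g := by
  have h : ∀ H : Y₂ → ℝ, wmean (p ∘ e) (H ∘ e) = wmean p H := fun H =>
    e.sum_comp (fun y => p y * H y)
  rw [wcov, wcov, h, h, ← h fun y => f y * g y]
  rfl

/-- The product weights on `Y ^ m`. -/
def wpi (p : Y → ℝ) (m : ℕ) : (Fin m → Y) → ℝ := fun y => ∏ l, p (y l)

lemma wpi_nonneg {Y : Type*} {p : Y → ℝ} (hp : ∀ y, 0 ≤ p y) (m : ℕ) (y : Fin m → Y) :
    0 ≤ wpi p m y :=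
  Finset.prod_nonneg fun _ _ => hp _

lemma sum_wpi_mul_prod {R : Type*} [CommSemiring R] (q : Y → R) (m : ℕ) :
    ∑ y : Fin m → Y, ∏ l, q (y l) = (∑ y, q y) ^ m := by
  classical
  simpa using (Finset.prod_univ_sum (fun _ : Fin m => (Finset.univ : Finset Y))
    (fun _ y => q y)).symm

lemma sum_wpi {p : Y → ℝ} (h1 : ∑ y, p y = 1) (m : ℕ) : ∑ y, wpi p m y = 1 := by
  simp only [wpi]
  rw [sum_wpi_mul_prod, h1, one_pow]

/-- Csáki–Fisher for `m` independent copies of one pair. -/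
lemma MaxCorrLE.pi {p : Y → ℝ} {A : Y → α} {B : Y → β} {ρ : ℝ} (hρ : 0 ≤ ρ) (hp : ∀ y, 0 ≤ p y)
    (hs : ∑ y, p y = 1) (h : MaxCorrLE p A B ρ) (m : ℕ) :
    MaxCorrLE (wpi p m) (fun y l => A (y l)) (fun y l => B (y l)) ρ := by
  induction m with
  | zero =>
    intro f g
    have : wcov (wpi p 0) (f ∘ fun y l => A (y l)) (g ∘ fun y l => B (y l)) = 0 := by
      simp [wcov, wmean, wpi]
    rw [this, abs_zero]
    positivity
  | succ m ih =>
    intro f g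
    have hc := MaxCorrLE.prod hρ hp hs (wpi_nonneg hp m) (sum_wpi hs m) h ih
      (fun a => f (Fin.cons a.1 a.2)) (fun b => g (Fin.cons b.1 b.2))
    have e : ∀ (φ ψ : (Fin (m + 1) → Y) → ℝ), wcov (wpi p (m + 1)) φ ψ =
        wcov (fun y : Y × (Fin m → Y) => p y.1 * wpi p m y.2)
          (fun y => φ (Fin.cons y.1 y.2)) (fun y => ψ (Fin.cons y.1 y.2)) := fun φ ψ => by
      rw [← wcov_equiv (Fin.consEquiv fun _ => Y)]
      congr 1
      funext y
      simp [wpi, Fin.prod_univ_succ, Fin.consEquiv]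
    have cA : ∀ y : Y × (Fin m → Y), (fun l => A ((Fin.cons y.1 y.2 : Fin (m + 1) → Y) l)) =
        Fin.cons (A y.1) fun l => A (y.2 l) := fun y => by
      funext l; refine Fin.cases ?_ (fun i => ?_) l <;> simp
    have cB : ∀ y : Y × (Fin m → Y), (fun l => B ((Fin.cons y.1 y.2 : Fin (m + 1) → Y) l)) =
        Fin.cons (B y.1) fun l => B (y.2 l) := fun y => by
      funext l; refine Fin.cases ?_ (fun i => ?_) l <;> simp
    simp only [e, Function.comp_def, cA, cB]
    exact hc

/-- The law of a rare particle: with probability `w y / m` the particle is of type `y`, and with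
the remaining probability there is none. -/
noncomputable def rareWeight (w : Y → ℝ) (m : ℝ) : Option Y → ℝ
  | none => 1 - (∑ y, w y) / m
  | some y => w y / m

lemma sum_rareWeight (w : Y → ℝ) (m : ℝ) : ∑ y, rareWeight w m y = 1 := by
  simp [Fintype.sum_option, rareWeight, Finset.sum_div]

lemma rareWeight_nonneg {w : Y → ℝ} (hw : ∀ y, 0 ≤ w y) {m : ℝ} (hm : 0 < m)
    (hwm : ∑ y, w y ≤ m) (y : Option Y) : 0 ≤ rareWeight w m y := by
  cases y with
  | none => simp only [rareWeight, sub_nonneg]; exact (div_le_one hm).2 hwm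
  | some y => exact div_nonneg (hw y) hm.le

/-- If the *uncentred* correlations of `A` and `B` under the intensity `w` are at most `κ` (for
functions which vanish on the empty state), then a rare particle with this intensity has maximal
correlation at most `κ`, up to the probability `ε` that the particle is there at all. -/
lemma maxCorrLE_rareWeight {w : Y → ℝ} (hw : ∀ y, 0 ≤ w y) {m : ℝ} (hm : 0 < m)
    (hwm : ∑ y, w y < m) {A : Option Y → α} {B : Option Y → β} {κ : ℝ} (hκ : 0 ≤ κ)
    (h : ∀ (f : α → ℝ) (g : β → ℝ), f (A none) = 0 → g (B none) = 0 →
      |∑ y, w y * (f (A (some y)) * g (B (some y)))| ≤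
        κ * (√(∑ y, w y * f (A (some y)) ^ 2) * √(∑ y, w y * g (B (some y)) ^ 2))) :
    MaxCorrLE (rareWeight w m) A B
      ((κ + (∑ y, w y) / m) / (1 - (∑ y, w y) / m)) := by
  set Λ := ∑ y, w y with hΛ
  have hΛ0 : 0 ≤ Λ := Finset.sum_nonneg fun y _ => hw y
  set ε := Λ / m with hε
  have hε1 : 0 < 1 - ε := by rw [sub_pos]; exact (div_lt_one hm).2 hwm
  have hε0 : 0 ≤ ε := div_nonneg hΛ0 hm.le
  -- by invariance under constants, `f` and `g` may be assumed to vanish on the empty state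
  suffices H : ∀ (f : α → ℝ) (g : β → ℝ), f (A none) = 0 → g (B none) = 0 →
      |wcov (rareWeight w m) (f ∘ A) (g ∘ B)| ≤ (κ + ε) / (1 - ε) *
        (√(wcov (rareWeight w m) (f ∘ A) (f ∘ A)) * √(wcov (rareWeight w m) (g ∘ B) (g ∘ B))) by
    intro f g
    have := H (fun a => f a - f (A none)) (fun b => g b - g (B none)) (sub_self _) (sub_self _)
    simp only [Function.comp_def] at this ⊢
    simpa only [wcov_sub_const (sum_rareWeight w m) (fun y => f (A y)),
      wcov_sub_const (sum_rareWeight w m) (fun y => g (B y))] using this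
  intro f g hf hg
  set Q : ℝ := ∑ y, w y * f (A (some y)) ^ 2 with hQ
  set R : ℝ := ∑ y, w y * g (B (some y)) ^ 2 with hR
  have hQ0 : 0 ≤ Q := Finset.sum_nonneg fun y _ => mul_nonneg (hw y) (sq_nonneg _)
  have hR0 : 0 ≤ R := Finset.sum_nonneg fun y _ => mul_nonneg (hw y) (sq_nonneg _)
  have eF : wmean (rareWeight w m) (f ∘ A) = (∑ y, w y * f (A (some y))) / m := by
    simp [wmean, Fintype.sum_option, rareWeight, hf, Finset.sum_div, div_mul_eq_mul_div]
  have eG : wmean (rareWeight w m) (g ∘ B) = (∑ y, w y * g (B (some y))) / m := by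
    simp [wmean, Fintype.sum_option, rareWeight, hg, Finset.sum_div, div_mul_eq_mul_div]
  have eFG : wmean (rareWeight w m) (fun y => (f ∘ A) y * (g ∘ B) y) =
      (∑ y, w y * (f (A (some y)) * g (B (some y)))) / m := by
    simp [wmean, Fintype.sum_option, rareWeight, hg, Finset.sum_div, div_mul_eq_mul_div]
  have eFF : wmean (rareWeight w m) (fun y => (f ∘ A) y * (f ∘ A) y) = Q / m := by
    simp [wmean, Fintype.sum_option, rareWeight, hf, Finset.sum_div, div_mul_eq_mul_div, hQ, sq]
  have eGG : wmean (rareWeight w m) (fun y => (g ∘ B) y * (g ∘ B) y) = R / m := by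
    simp [wmean, Fintype.sum_option, rareWeight, hg, Finset.sum_div, div_mul_eq_mul_div, hR, sq]
  have bF : |∑ y, w y * f (A (some y))| ≤ √Λ * √Q := by
    have := sum_mul_abs_le (v := fun _ : Y => (1 : ℝ)) (w := fun y => f (A (some y))) hw
    simp only [abs_one, one_mul, one_pow, mul_one] at this
    refine ((Finset.abs_sum_le_sum_abs _ _).trans (le_of_eq ?_)).trans this
    exact Finset.sum_congr rfl fun y _ => by rw [abs_mul, abs_of_nonneg (hw y)]
  have bG : |∑ y, w y * g (B (some y))| ≤ √Λ * √R := by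
    have := sum_mul_abs_le (v := fun _ : Y => (1 : ℝ)) (w := fun y => g (B (some y))) hw
    simp only [abs_one, one_mul, one_pow, mul_one] at this
    refine ((Finset.abs_sum_le_sum_abs _ _).trans (le_of_eq ?_)).trans this
    exact Finset.sum_congr rfl fun y _ => by rw [abs_mul, abs_of_nonneg (hw y)]
  have vF : (1 - ε) * (Q / m) ≤ wcov (rareWeight w m) (f ∘ A) (f ∘ A) := by
    have : (∑ y, w y * f (A (some y))) ^ 2 ≤ Λ * Q := by
      rw [← sq_abs]
      calc _ ≤ (√Λ * √Q) ^ 2 := pow_le_pow_left₀ (abs_nonneg _) bF 2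
        _ = Λ * Q := by rw [mul_pow, Real.sq_sqrt hΛ0, Real.sq_sqrt hQ0]
    rw [wcov, eFF, eF, div_mul_div_comm, ← sq, sub_mul, one_mul, hε, div_mul_div_comm]
    gcongr
  have vG : (1 - ε) * (R / m) ≤ wcov (rareWeight w m) (g ∘ B) (g ∘ B) := by
    have : (∑ y, w y * g (B (some y))) ^ 2 ≤ Λ * R := by
      rw [← sq_abs]
      calc _ ≤ (√Λ * √R) ^ 2 := pow_le_pow_left₀ (abs_nonneg _) bG 2
        _ = Λ * R := by rw [mul_pow, Real.sq_sqrt hΛ0, Real.sq_sqrt hR0]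
    rw [wcov, eGG, eG, div_mul_div_comm, ← sq, sub_mul, one_mul, hε, div_mul_div_comm]
    gcongr
  calc |wcov (rareWeight w m) (f ∘ A) (g ∘ B)|
      ≤ κ * (√Q * √R) / m + (√Λ * √Q) * (√Λ * √R) / (m * m) := by
        rw [wcov, eFG, eF, eG, div_mul_div_comm]
        refine (abs_sub _ _).trans (add_le_add ?_ ?_)
        · rw [abs_div, abs_of_pos hm]
          gcongr
          exact h f g hf hg
        · rw [abs_div, abs_mul, abs_of_pos (mul_pos hm hm)]
          gcongr
    _ = (κ + ε) * ((√Q * √R) / m) := by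
        rw [mul_mul_mul_comm, Real.mul_self_sqrt hΛ0, hε]
        field_simp
    _ = (κ + ε) / (1 - ε) * (√((1 - ε) * (Q / m)) * √((1 - ε) * (R / m))) := by
        rw [Real.sqrt_mul hε1.le, Real.sqrt_mul hε1.le, mul_mul_mul_comm,
          Real.mul_self_sqrt hε1.le, Real.sqrt_div hQ0, Real.sqrt_div hR0, div_mul_div_comm,
          Real.mul_self_sqrt hm.le]
        field_simp
    _ ≤ _ := by gcongr

end Finite

/-! ### A Schur test for functions that are piecewise constant between points of a set -/

/-- The Schur test: a nonnegative kernel on `S × T` with row and column sums at most `κ` has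
operator norm at most `κ`. -/
lemma schur_test {ι : Type*} (S T : Finset ι) {k : ι → ι → ℝ} (hk : ∀ s t, 0 ≤ k s t) {κ : ℝ}
    (hrow : ∀ s ∈ S, ∑ t ∈ T, k s t ≤ κ) (hcol : ∀ t ∈ T, ∑ s ∈ S, k s t ≤ κ) (hκ : 0 ≤ κ)
    (p q : ι → ℝ) :
    ∑ s ∈ S, ∑ t ∈ T, k s t * (|p s| * |q t|) ≤
      κ * (√(∑ s ∈ S, p s ^ 2) * √(∑ t ∈ T, q t ^ 2)) := by
  have h := sum_mul_abs_le (Y := S × T) (p := fun y => k y.1 y.2) (v := fun y => p y.1)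
    (w := fun y => q y.2) (fun y => hk _ _)
  rw [Fintype.sum_prod_type, Fintype.sum_prod_type, Fintype.sum_prod_type_right] at h
  simp only [← Finset.sum_mul] at h
  have e : ∑ s ∈ S, ∑ t ∈ T, k s t * (|p s| * |q t|) =
      ∑ x : S, ∑ y : T, k x y * (|p x| * |q y|) := by
    rw [← Finset.sum_coe_sort S]
    exact Finset.sum_congr rfl fun x _ => (Finset.sum_coe_sort T _).symm
  rw [e]
  refine h.trans ?_
  have h₁ : ∑ x : S, (∑ y : T, k x y) * p x ^ 2 ≤ κ * ∑ s ∈ S, p s ^ 2 := by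
    rw [← Finset.sum_coe_sort S, Finset.mul_sum]
    refine Finset.sum_le_sum fun x _ => mul_le_mul_of_nonneg_right ?_ (sq_nonneg _)
    rw [Finset.sum_coe_sort T (fun y => k x y)]
    exact hrow x x.2
  have h₂ : ∑ y : T, (∑ x : S, k x y) * q y ^ 2 ≤ κ * ∑ t ∈ T, q t ^ 2 := by
    rw [← Finset.sum_coe_sort T, Finset.mul_sum]
    refine Finset.sum_le_sum fun y _ => mul_le_mul_of_nonneg_right ?_ (sq_nonneg _)
    rw [Finset.sum_coe_sort S (fun x => k x y)]
    exact hcol y y.2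
  calc _ ≤ √(κ * ∑ s ∈ S, p s ^ 2) * √(κ * ∑ t ∈ T, q t ^ 2) := by gcongr
    _ = _ := by
      rw [Real.sqrt_mul hκ, Real.sqrt_mul hκ, mul_mul_mul_comm, Real.mul_self_sqrt hκ]

/-- If every value `φ i ≠ 0` is attained at a point of `S` which is `r`-related to `i`, and
likewise for `ψ` and `T`, then the `u`-weighted inner product of `φ` and `ψ` is controlled by the
kernel `k s t` which compares the mass of the common `r`-predecessors of `s` and `t` to
`√(u s * u t)`. -/
lemma abs_sum_mul_le_of_schur {ι : Type*} [Fintype ι] (r : ι → ι → Prop) [DecidableRel r]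
    (S T : Finset ι) {u : ι → ℝ}
    (hu : ∀ i, 0 ≤ u i) {k : ι → ι → ℝ} (hk : ∀ s t, 0 ≤ k s t) {κ : ℝ} (hκ : 0 ≤ κ)
    (hrow : ∀ s ∈ S, ∑ t ∈ T, k s t ≤ κ) (hcol : ∀ t ∈ T, ∑ s ∈ S, k s t ≤ κ)
    (hku : ∀ s ∈ S, ∀ t ∈ T,
      (∑ i, if r i s ∧ r i t then u i else 0) ≤ k s t * (√(u s) * √(u t)))
    {φ ψ : ι → ℝ} (hφ : ∀ i, φ i ≠ 0 → ∃ s ∈ S, r i s ∧ φ s = φ i)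
    (hψ : ∀ i, ψ i ≠ 0 → ∃ t ∈ T, r i t ∧ ψ t = ψ i) :
    |∑ i, u i * (φ i * ψ i)| ≤ κ * (√(∑ i, u i * φ i ^ 2) * √(∑ i, u i * ψ i ^ 2)) := by
  have bd : ∀ (R : Finset ι) (χ : ι → ℝ), (∀ i, χ i ≠ 0 → ∃ s ∈ R, r i s ∧ χ s = χ i) →
      ∀ i, |χ i| ≤ ∑ s ∈ R, if r i s then |χ s| else 0 := by
    intro R χ hχ i
    by_cases h0 : χ i = 0
    · rw [h0, abs_zero]
      exact Finset.sum_nonneg fun s _ => by split_ifs <;> positivity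
    · obtain ⟨s, hs, hr, he⟩ := hχ i h0
      refine le_trans ?_ (Finset.single_le_sum
        (f := fun s => if r i s then |χ s| else 0) (fun s _ => ?_) hs)
      · simp [hr, he]
      · split_ifs <;> positivity
  have sq_le : ∀ (R : Finset ι) (χ : ι → ℝ),
      ∑ s ∈ R, (√(u s) * χ s) ^ 2 ≤ ∑ i, u i * χ i ^ 2 := fun R χ => by
    simp only [mul_pow, Real.sq_sqrt (hu _)]
    exact Finset.sum_le_sum_of_subset_of_nonneg (Finset.subset_univ _)
      fun i _ _ => mul_nonneg (hu i) (sq_nonneg _)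
  calc |∑ i, u i * (φ i * ψ i)|
      ≤ ∑ i, u i * ((∑ s ∈ S, if r i s then |φ s| else 0) *
          ∑ t ∈ T, if r i t then |ψ t| else 0) := by
        refine (Finset.abs_sum_le_sum_abs _ _).trans (Finset.sum_le_sum fun i _ => ?_)
        rw [abs_mul, abs_mul, abs_of_nonneg (hu i)]
        exact mul_le_mul_of_nonneg_left (mul_le_mul (bd S φ hφ i) (bd T ψ hψ i) (abs_nonneg _)
          ((abs_nonneg _).trans (bd S φ hφ i))) (hu i)
    _ = ∑ s ∈ S, ∑ t ∈ T, (∑ i, if r i s ∧ r i t then u i else 0) * (|φ s| * |ψ t|) := by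
        simp_rw [Finset.sum_mul_sum, Finset.mul_sum]
        rw [Finset.sum_comm]
        refine Finset.sum_congr rfl fun s _ => ?_
        rw [Finset.sum_comm]
        refine Finset.sum_congr rfl fun t _ => ?_
        rw [Finset.sum_mul]
        refine Finset.sum_congr rfl fun i _ => ?_
        by_cases h₁ : r i s <;> by_cases h₂ : r i t <;> simp [h₁, h₂]
    _ ≤ ∑ s ∈ S, ∑ t ∈ T, k s t * (|√(u s) * φ s| * |√(u t) * ψ t|) := by
        refine Finset.sum_le_sum fun s hs => Finset.sum_le_sum fun t ht => ?_
        rw [abs_mul, abs_mul, abs_of_nonneg (Real.sqrt_nonneg _),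
          abs_of_nonneg (Real.sqrt_nonneg _)]
        refine (mul_le_mul_of_nonneg_right (hku s hs t ht) (by positivity)).trans (le_of_eq ?_)
        ring
    _ ≤ κ * (√(∑ s ∈ S, (√(u s) * φ s) ^ 2) * √(∑ t ∈ T, (√(u t) * ψ t) ^ 2)) :=
        schur_test S T hk hrow hcol hκ _ _
    _ ≤ _ := by
        gcongr
        · exact sq_le S φ
        · exact sq_le T ψ

/-! ### Particles living on intervals of a finite time window -/

/-- A geometric series over a finite set of exponents that are all at least `n`. -/
lemma sum_pow_le_of_le {θ : ℝ} (h0 : 0 ≤ θ) (h1 : θ < 1) (n : ℕ) (D : Finset ℕ)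
    (hD : ∀ d ∈ D, n ≤ d) : ∑ d ∈ D, θ ^ d ≤ θ ^ n / (1 - θ) := by
  have e : ∑ d ∈ D, θ ^ d = θ ^ n * ∑ e ∈ D.image (· - n), θ ^ e := by
    rw [Finset.sum_image, Finset.mul_sum]
    · refine Finset.sum_congr rfl fun d hd => ?_
      rw [← pow_add, Nat.add_sub_cancel' (hD d hd)]
    · intro x hx y hy hxy
      have := hD x hx
      have := hD y hy
      simp only at hxy
      omega
  rw [e, div_eq_mul_inv, ← tsum_geometric_of_lt_one h0 h1]
  exact mul_le_mul_of_nonneg_left ((summable_geometric_of_lt_one h0 h1).sum_le_tsum _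
    fun i _ => pow_nonneg h0 i) (pow_nonneg h0 n)

lemma sum_pow_dist_le {θ : ℝ} (h0 : 0 ≤ θ) (h1 : θ < 1) {M : ℕ} (n : ℕ) (T : Finset (Fin (M + 1)))
    (s : Fin (M + 1)) (hT : ∀ t ∈ T, n ≤ ((s : ℤ) - t).natAbs) :
    ∑ t ∈ T, θ ^ ((s : ℤ) - t).natAbs ≤ 2 * θ ^ n / (1 - θ) := by
  rw [← Finset.sum_filter_add_sum_filter_not T (fun t => s ≤ t), two_mul, add_div]
  refine add_le_add ?_ ?_
  · rw [← Finset.sum_image (s := T.filter fun t => s ≤ t)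
      (g := fun t : Fin (M + 1) => ((s : ℤ) - t).natAbs) (f := fun d => θ ^ d)]
    · refine sum_pow_le_of_le h0 h1 n _ fun d hd => ?_
      obtain ⟨t, ht, rfl⟩ := Finset.mem_image.1 hd
      exact hT t (Finset.mem_filter.1 ht).1
    · intro x hx y hy hxy
      simp only [Finset.coe_filter, Set.mem_ofPred_eq, Fin.le_def] at hx hy
      ext
      simp only at hxy
      omega
  · rw [← Finset.sum_image (s := T.filter fun t => ¬ s ≤ t)
      (g := fun t : Fin (M + 1) => ((s : ℤ) - t).natAbs) (f := fun d => θ ^ d)]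
    · refine sum_pow_le_of_le h0 h1 n _ fun d hd => ?_
      obtain ⟨t, ht, rfl⟩ := Finset.mem_image.1 hd
      exact hT t (Finset.mem_filter.1 ht).1
    · intro x hx y hy hxy
      simp only [Finset.coe_filter, Set.mem_ofPred_eq, Fin.le_def] at hx hy
      ext
      simp only at hxy
      omega

/-- The weight of the particles of the window `{0, …, M}` which are born at time `i`, up to a
factor that depends on the time of death. Those which are older than the window are counted
as born at time `0`. -/
noncomputable def birthWeight (a : ℝ) (i : ℕ) : ℝ := if i = 0 then (1 - a)⁻¹ else (a⁻¹) ^ i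

/-- The weight of the particles of the window `{0, …, M}` which are last alive at time `j`. Those
which survive the window are counted as last alive at time `M`. -/
noncomputable def deathWeight (a : ℝ) (M j : ℕ) : ℝ := if j < M then (1 - a) * a ^ j else a ^ j

lemma birthWeight_pos {a : ℝ} (ha0 : 0 < a) (ha1 : a < 1) (i : ℕ) : 0 < birthWeight a i := by
  have := sub_pos.2 ha1
  rw [birthWeight]; split_ifs <;> positivity

lemma deathWeight_pos {a : ℝ} (ha0 : 0 < a) (ha1 : a < 1) (M j : ℕ) : 0 < deathWeight a M j := by
  have := sub_pos.2 ha1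
  rw [deathWeight]; split_ifs <;> positivity

lemma sum_birthWeight {a : ℝ} (ha0 : 0 < a) (ha1 : a < 1) (s : ℕ) :
    ∑ i ∈ Finset.range (s + 1), birthWeight a i = (1 - a)⁻¹ * (a⁻¹) ^ s := by
  have h1 : 1 - a ≠ 0 := (sub_pos.2 ha1).ne'
  induction s with
  | zero => simp [birthWeight]
  | succ s ih =>
    rw [Finset.sum_range_succ, ih, birthWeight, if_neg (Nat.succ_ne_zero s), pow_succ]
    field_simp
    ring

lemma sum_deathWeight (a : ℝ) {M s : ℕ} (hs : s ≤ M) :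
    ∑ j ∈ Finset.Ico s (M + 1), deathWeight a M j = a ^ s := by
  induction hs using Nat.decreasingInduction with
  | self => simp [deathWeight]
  | of_succ s hs ih =>
    rw [Finset.sum_eq_sum_Ico_succ_bot (by omega), ih, deathWeight, if_pos hs]
    ring

lemma pow_le_sqrt_birthWeight {a : ℝ} (ha0 : 0 < a) (ha1 : a < 1) (s : ℕ) :
    ((√a)⁻¹) ^ s ≤ √(birthWeight a s) := by
  have h1 := sub_pos.2 ha1
  rw [← Real.sqrt_inv]
  refine Real.le_sqrt_of_sq_le ?_
  rw [← pow_mul, mul_comm, pow_mul, Real.sq_sqrt (by positivity), birthWeight]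
  split_ifs with h
  · subst h
    rw [pow_zero]
    exact (one_le_inv₀ h1).2 (by linarith)
  · exact le_rfl

lemma pow_le_sqrt_deathWeight {a : ℝ} (ha0 : 0 < a) (ha1 : a < 1) (M s : ℕ) :
    √(1 - a) * (√a) ^ s ≤ √(deathWeight a M s) := by
  have h1 := sub_pos.2 ha1
  refine Real.le_sqrt_of_sq_le ?_
  rw [mul_pow, Real.sq_sqrt h1.le, ← pow_mul, mul_comm s, pow_mul, Real.sq_sqrt ha0.le,
    deathWeight]
  split_ifs with h
  · exact le_rfl
  · exact mul_le_of_le_one_left (by positivity) (by linarith)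

lemma sum_birthWeight_le {a : ℝ} (ha0 : 0 < a) (ha1 : a < 1) {M : ℕ} (s t : Fin (M + 1)) :
    (∑ i : Fin (M + 1), if i ≤ s ∧ i ≤ t then birthWeight a i else 0) ≤
      ((1 - a)⁻¹ * √a ^ ((s : ℤ) - t).natAbs) *
        (√(birthWeight a s) * √(birthWeight a t)) := by
  have h1 := sub_pos.2 ha1
  have e : (∑ i : Fin (M + 1), if i ≤ s ∧ i ≤ t then birthWeight a i else 0) =
      ∑ i ∈ Finset.range (min (s : ℕ) t + 1), birthWeight a i := by
    simp only [Fin.le_def]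
    rw [Fin.sum_univ_eq_sum_range
      (fun i => if i ≤ (s : ℕ) ∧ i ≤ (t : ℕ) then birthWeight a i else 0) (M + 1),
      ← Finset.sum_filter]
    refine Finset.sum_congr ?_ fun _ _ => rfl
    ext i
    simp only [Finset.mem_filter, Finset.mem_range]
    omega
  rw [e, sum_birthWeight ha0 ha1]
  have hs : (0 : ℝ) < √a := Real.sqrt_pos.2 ha0
  calc (1 - a)⁻¹ * a⁻¹ ^ min (s : ℕ) t
      = ((1 - a)⁻¹ * √a ^ ((s : ℤ) - t).natAbs) * ((√a)⁻¹ ^ (s : ℕ) * (√a)⁻¹ ^ (t : ℕ)) := by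
        rw [mul_assoc, ← pow_add]
        congr 1
        have : (s : ℕ) + t = ((s : ℤ) - t).natAbs + 2 * min (s : ℕ) t := by omega
        rw [this, pow_add, ← mul_assoc, ← mul_pow, mul_inv_cancel₀ hs.ne', one_pow, one_mul,
          pow_mul, ← Real.sqrt_inv, Real.sq_sqrt (inv_nonneg.2 ha0.le)]
    _ ≤ _ := by
        gcongr
        · exact pow_le_sqrt_birthWeight ha0 ha1 s
        · exact pow_le_sqrt_birthWeight ha0 ha1 t

lemma sum_deathWeight_le {a : ℝ} (ha0 : 0 < a) (ha1 : a < 1) {M : ℕ} (s t : Fin (M + 1)) :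
    (∑ j : Fin (M + 1), if s ≤ j ∧ t ≤ j then deathWeight a M j else 0) ≤
      ((1 - a)⁻¹ * √a ^ ((s : ℤ) - t).natAbs) *
        (√(deathWeight a M s) * √(deathWeight a M t)) := by
  have h1 := sub_pos.2 ha1
  have e : (∑ j : Fin (M + 1), if s ≤ j ∧ t ≤ j then deathWeight a M j else 0) =
      ∑ j ∈ Finset.Ico (max (s : ℕ) t) (M + 1), deathWeight a M j := by
    simp only [Fin.le_def]
    rw [Fin.sum_univ_eq_sum_range
      (fun j => if (s : ℕ) ≤ j ∧ (t : ℕ) ≤ j then deathWeight a M j else 0) (M + 1),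
      ← Finset.sum_filter]
    refine Finset.sum_congr ?_ fun _ _ => rfl
    ext i
    simp only [Finset.mem_filter, Finset.mem_range, Finset.mem_Ico]
    omega
  rw [e, sum_deathWeight a (by omega)]
  have hs : (0 : ℝ) < √a := Real.sqrt_pos.2 ha0
  calc a ^ max (s : ℕ) t
      = ((1 - a)⁻¹ * √a ^ ((s : ℤ) - t).natAbs) *
          ((√(1 - a) * √a ^ (s : ℕ)) * (√(1 - a) * √a ^ (t : ℕ))) := by
        rw [mul_mul_mul_comm √(1 - a), Real.mul_self_sqrt h1.le, mul_mul_mul_comm,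
          inv_mul_cancel₀ h1.ne', one_mul, ← pow_add, ← pow_add]
        have : ((s : ℤ) - t).natAbs + ((s : ℕ) + t) = 2 * max (s : ℕ) t := by omega
        rw [this, pow_mul, Real.sq_sqrt ha0.le]
    _ ≤ _ := by
        gcongr
        · exact pow_le_sqrt_deathWeight ha0 ha1 M s
        · exact pow_le_sqrt_deathWeight ha0 ha1 M t

/-- The trace on `S` of a particle which is alive from time `y.1` to time `y.2`: the indicator
function of `S ∩ [y.1, y.2]`. -/
def intervalTrace {M : ℕ} (S : Finset (Fin (M + 1))) (y : Fin (M + 1) × Fin (M + 1)) :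
    Fin (M + 1) → ℕ :=
  fun k => if k ∈ S ∧ y.1 ≤ k ∧ k ≤ y.2 then 1 else 0

lemma exists_mem_of_intervalTrace_ne {M : ℕ} {S : Finset (Fin (M + 1))}
    {f : (Fin (M + 1) → ℕ) → ℝ} (hf : f 0 = 0) {i j : Fin (M + 1)}
    (h : f (intervalTrace S (i, j)) ≠ 0) : ∃ s ∈ S, i ≤ s ∧ s ≤ j := by
  by_contra! hc
  refine h ?_
  rw [← hf]
  congr 1
  funext k
  simp only [intervalTrace, Pi.zero_apply, ite_eq_right_iff, one_ne_zero, imp_false, not_and]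
  exact fun hk hi hj => absurd hj (not_le.2 (hc k hk hi))

/-- Only the first point of `S` in an interval matters for the trace on `S`. -/
lemma exists_first_mem {M : ℕ} {S : Finset (Fin (M + 1))} {f : (Fin (M + 1) → ℕ) → ℝ}
    (hf : f 0 = 0) {i j : Fin (M + 1)} (h : f (intervalTrace S (i, j)) ≠ 0) :
    ∃ s ∈ S, i ≤ s ∧ f (intervalTrace S (s, j)) = f (intervalTrace S (i, j)) := by
  obtain ⟨s₀, hs₀, hi₀, -⟩ := exists_mem_of_intervalTrace_ne hf h
  have hne : (S.filter fun s => i ≤ s).Nonempty := ⟨s₀, Finset.mem_filter.2 ⟨hs₀, hi₀⟩⟩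
  have hm := Finset.min'_mem _ hne
  refine ⟨(S.filter fun s => i ≤ s).min' hne, (Finset.mem_filter.1 hm).1,
    (Finset.mem_filter.1 hm).2, ?_⟩
  congr 1
  funext k
  simp only [intervalTrace]
  refine if_congr (and_congr_right fun hk => and_congr_left fun _ => ⟨fun h' => ?_, fun h' => ?_⟩)
    rfl rfl
  · exact (Finset.mem_filter.1 hm).2.trans h'
  · exact Finset.min'_le _ _ (Finset.mem_filter.2 ⟨hk, h'⟩)

/-- Only the last point of `S` before `j` matters for the trace on `S` of the intervals that
end at `j`, simultaneously for all starting points. -/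
lemma exists_last_mem {M : ℕ} {S : Finset (Fin (M + 1))} {f : (Fin (M + 1) → ℕ) → ℝ}
    (hf : f 0 = 0) {i j : Fin (M + 1)} (h : f (intervalTrace S (i, j)) ≠ 0) :
    ∃ s ∈ S, s ≤ j ∧ ∀ i', f (intervalTrace S (i', s)) = f (intervalTrace S (i', j)) := by
  obtain ⟨s₀, hs₀, -, hj₀⟩ := exists_mem_of_intervalTrace_ne hf h
  have hne : (S.filter fun s => s ≤ j).Nonempty := ⟨s₀, Finset.mem_filter.2 ⟨hs₀, hj₀⟩⟩
  have hm := Finset.max'_mem _ hne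
  refine ⟨(S.filter fun s => s ≤ j).max' hne, (Finset.mem_filter.1 hm).1,
    (Finset.mem_filter.1 hm).2, fun i' => ?_⟩
  congr 1
  funext k
  simp only [intervalTrace]
  refine if_congr (and_congr_right fun hk => and_congr_right fun _ => ⟨fun h' => ?_, fun h' => ?_⟩)
    rfl rfl
  · exact h'.trans (Finset.mem_filter.1 hm).2
  · exact Finset.le_max' _ _ (Finset.mem_filter.2 ⟨hk, h'⟩)

/-- The intensity of the particles which are alive from time `y.1` to time `y.2`. Pairs with
`y.2 < y.1` stand for particles which are never alive; they are harmless. -/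
noncomputable def particleWeight (a lam : ℝ) {M : ℕ} (y : Fin (M + 1) × Fin (M + 1)) : ℝ :=
  lam * (birthWeight a y.1 * deathWeight a M y.2)

/-- The contribution of one end point (birth or death) to the bound for the uncentred correlation
of one particle; it is the operator norm which the Schur test yields. -/
noncomputable def schurConst (a : ℝ) (n : ℕ) : ℝ := (1 - a)⁻¹ * (2 * √a ^ n / (1 - √a))

lemma schurConst_nonneg {a : ℝ} (ha1 : a < 1) (n : ℕ) : 0 ≤ schurConst a n := by
  have h1 := sub_pos.2 ha1
  have h2 : √a < 1 := by rw [Real.sqrt_lt' one_pos]; simpa using ha1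
  have h3 := sub_pos.2 h2
  rw [schurConst]
  positivity

/-- Uncentred correlations between the traces of one particle on two sets at distance at least `n`
are of order `a ^ n`: the weight of `[i, j]` is a product of a function of `i` and a function of
`j`, so that the Schur test applies to the two end points separately. -/
lemma abs_sum_particleWeight_le {a lam : ℝ} (ha0 : 0 < a) (ha1 : a < 1) (hlam : 0 ≤ lam) {M n : ℕ}
    {S T : Finset (Fin (M + 1))} (hST : ∀ s ∈ S, ∀ t ∈ T, n ≤ ((s : ℤ) - t).natAbs)
    {f g : (Fin (M + 1) → ℕ) → ℝ} (hf : f 0 = 0) (hg : g 0 = 0) :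
    |∑ y, particleWeight a lam y * (f (intervalTrace S y) * g (intervalTrace T y))| ≤
      schurConst a n ^ 2 * (√(∑ y, particleWeight a lam y * f (intervalTrace S y) ^ 2) *
        √(∑ y, particleWeight a lam y * g (intervalTrace T y) ^ 2)) := by
  classical
  have h1 := sub_pos.2 ha1
  have hθ1 : √a < 1 := by rw [Real.sqrt_lt' one_pos]; simpa using ha1
  have hκ := schurConst_nonneg ha1 n
  set κ := schurConst a n with hκdef
  set u : Fin (M + 1) → ℝ := fun i => birthWeight a i
  set v : Fin (M + 1) → ℝ := fun j => deathWeight a M j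
  have hu : ∀ i, 0 ≤ u i := fun i => (birthWeight_pos ha0 ha1 i).le
  have hv : ∀ j, 0 ≤ v j := fun j => (deathWeight_pos ha0 ha1 M j).le
  set k : Fin (M + 1) → Fin (M + 1) → ℝ := fun s t => (1 - a)⁻¹ * √a ^ ((s : ℤ) - t).natAbs
  have hk : ∀ s t, 0 ≤ k s t := fun s t => by positivity
  have hrow : ∀ s ∈ S, ∑ t ∈ T, k s t ≤ κ := fun s hs => by
    rw [← Finset.mul_sum]
    exact mul_le_mul_of_nonneg_left
      (sum_pow_dist_le (Real.sqrt_nonneg a) hθ1 n T s (hST s hs)) (by positivity)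
  have hcol : ∀ t ∈ T, ∑ s ∈ S, k s t ≤ κ := fun t ht => by
    have e : ∀ s : Fin (M + 1), ((s : ℤ) - t).natAbs = ((t : ℤ) - s).natAbs := fun s => by omega
    simp only [k, e]
    rw [← Finset.mul_sum]
    exact mul_le_mul_of_nonneg_left (sum_pow_dist_le (Real.sqrt_nonneg a) hθ1 n S t
      fun s hs => (e s) ▸ hST s hs t ht) (by positivity)
  set F : Fin (M + 1) → Fin (M + 1) → ℝ := fun i j => f (intervalTrace S (i, j))
  set G : Fin (M + 1) → Fin (M + 1) → ℝ := fun i j => g (intervalTrace T (i, j))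
  set NF : Fin (M + 1) → ℝ := fun j => √(∑ i, u i * F i j ^ 2)
  set NG : Fin (M + 1) → ℝ := fun j => √(∑ i, u i * G i j ^ 2)
  have inner : ∀ j, |∑ i, u i * (F i j * G i j)| ≤ κ * (NF j * NG j) := fun j =>
    abs_sum_mul_le_of_schur (fun i s => i ≤ s) S T hu hk hκ hrow hcol
      (fun s _ t _ => sum_birthWeight_le ha0 ha1 s t)
      (fun i hi => exists_first_mem hf hi) (fun i hi => exists_first_mem hg hi)
  have norm_last : ∀ (R : Finset (Fin (M + 1))) (h : (Fin (M + 1) → ℕ) → ℝ), h 0 = 0 → ∀ j,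
      √(∑ i, u i * h (intervalTrace R (i, j)) ^ 2) ≠ 0 → ∃ s ∈ R, s ≤ j ∧
        √(∑ i, u i * h (intervalTrace R (i, s)) ^ 2) =
          √(∑ i, u i * h (intervalTrace R (i, j)) ^ 2) := by
    intro R h h0 j hj
    have : ∃ i, h (intervalTrace R (i, j)) ≠ 0 := by
      by_contra! hc
      exact hj (by simp [hc])
    obtain ⟨i, hi⟩ := this
    obtain ⟨s, hs, hsj, he⟩ := exists_last_mem h0 hi
    exact ⟨s, hs, hsj, by simp only [he]⟩
  have outer : |∑ j, v j * (NF j * NG j)| ≤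
      κ * (√(∑ j, v j * NF j ^ 2) * √(∑ j, v j * NG j ^ 2)) :=
    abs_sum_mul_le_of_schur (fun j s => s ≤ j) S T hv hk hκ hrow hcol
      (fun s _ t _ => sum_deathWeight_le ha0 ha1 s t)
      (fun j hj => norm_last S f hf j hj) (fun j hj => norm_last T g hg j hj)
  have split : ∀ H : Fin (M + 1) × Fin (M + 1) → ℝ, ∑ y, particleWeight a lam y * H y =
      lam * ∑ j, v j * ∑ i, u i * H (i, j) := fun H => by
    rw [Fintype.sum_prod_type_right]
    simp only [Finset.mul_sum, particleWeight, u, v]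
    exact Finset.sum_congr rfl fun j _ => Finset.sum_congr rfl fun i _ => by ring
  have eF : ∑ y, particleWeight a lam y * f (intervalTrace S y) ^ 2 =
      lam * ∑ j, v j * NF j ^ 2 := by
    simp only [split, NF, Real.sq_sqrt (Finset.sum_nonneg fun i _ =>
      mul_nonneg (hu i) (sq_nonneg _)), F]
  have eG : ∑ y, particleWeight a lam y * g (intervalTrace T y) ^ 2 =
      lam * ∑ j, v j * NG j ^ 2 := by
    simp only [split, NG, Real.sq_sqrt (Finset.sum_nonneg fun i _ =>
      mul_nonneg (hu i) (sq_nonneg _)), G]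
  rw [eF, eG, split, abs_mul, abs_of_nonneg hlam, Real.sqrt_mul hlam, Real.sqrt_mul hlam,
    mul_mul_mul_comm, Real.mul_self_sqrt hlam, mul_left_comm]
  refine mul_le_mul_of_nonneg_left ?_ hlam
  calc |∑ j, v j * ∑ i, u i * (F i j * G i j)| ≤ ∑ j, v j * (κ * (NF j * NG j)) := by
        refine (Finset.abs_sum_le_sum_abs _ _).trans (Finset.sum_le_sum fun j _ => ?_)
        rw [abs_mul, abs_of_nonneg (hv j)]
        exact mul_le_mul_of_nonneg_left (inner j) (hv j)
    _ = κ * ∑ j, v j * (NF j * NG j) := by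
        rw [Finset.mul_sum]
        exact Finset.sum_congr rfl fun j _ => by ring
    _ ≤ κ * (κ * (√(∑ j, v j * NF j ^ 2) * √(∑ j, v j * NG j ^ 2))) :=
        mul_le_mul_of_nonneg_left ((le_abs_self _).trans outer) hκ
    _ = _ := by rw [← mul_assoc, ← sq]

/-! ### The generating function of the process on a finite window -/

/-- The generating function of the binomial distribution. -/
lemma sum_binomial_mul_pow (a : unitInterval) (x N : ℕ) (hN : x < N) (z : ℂ) :
    ∑ u ∈ Finset.range N, ((binomial x a).real {u} : ℂ) * z ^ u =
      (1 - (a : ℝ) + (a : ℝ) * z) ^ x := by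
  have h0 : ∀ u ∈ Finset.range N, u ∉ Finset.range (x + 1) →
      ((binomial x a).real {u} : ℂ) * z ^ u = 0 := fun u _ hu => by
    rw [Finset.mem_range, not_lt] at hu
    rw [binomial_real_singleton, Nat.choose_eq_zero_of_lt hu]
    simp
  rw [← Finset.sum_subset (Finset.range_subset_range.2 hN) h0, add_comm, add_pow]
  refine Finset.sum_congr rfl fun u _ => ?_
  rw [binomial_real_singleton]
  push_cast
  ring

lemma sum_binomial_le_one (a : unitInterval) (x N : ℕ) :
    ∑ u ∈ Finset.range N, (binomial x a).real {u} ≤ 1 := by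
  rw [sum_measureReal_singleton]
  exact measureReal_le_one

/-- The generating function of the Poisson distribution. -/
lemma integral_pow_poissonMeasure (r : ℝ≥0) (z : ℂ) :
    ∫ n, z ^ n ∂(poissonMeasure r) = Complex.exp ((r : ℝ) * (z - 1)) := by
  rw [integral_poissonMeasure r]
  have h : ∀ n : ℕ, (Real.exp (-r) * (r : ℝ) ^ n / n.factorial) • z ^ n =
      Complex.exp (-(r : ℝ)) * (((r : ℝ) * z) ^ n / n.factorial) := fun n => by
    rw [Complex.real_smul]
    push_cast
    rw [mul_pow]
    ring
  simp_rw [h]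
  rw [tsum_mul_left, (NormedSpace.expSeries_div_hasSum_exp (((r : ℝ) : ℂ) * z)).tsum_eq,
    ← Complex.exp_eq_exp_ℂ, ← Complex.exp_add]
  ring_nf

variable {Ω : Type*} {mΩ : MeasurableSpace Ω} {P : Measure Ω}

lemma sigmaGen_singleton (Z : ℤ → Ω → ℕ) (k : ℤ) :
    sigmaGen Z {k} = MeasurableSpace.comap (Z k) ⊤ := by
  simp [sigmaGen]

lemma sigmaGen_le {Z : ℤ → Ω → ℕ} (hZ : ∀ k, Measurable (Z k)) (S : Set ℤ) :
    sigmaGen Z S ≤ mΩ :=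
  iSup₂_le fun k _ => (hZ k).comap_le

lemma measurable_sigmaGen (Z : ℤ → Ω → ℕ) {S : Set ℤ} {k : ℤ} (hk : k ∈ S) :
    Measurable[sigmaGen Z S] (Z k) :=
  measurable_iff_comap_le.2 (le_iSup₂ (f := fun k _ => MeasurableSpace.comap (Z k) ⊤) k hk)

/-- Elementary conditional laws of `U` given `X = x` determine the conditional probabilities of
`U = u` given `σ(X)`: a version of the latter is a function of `X`, and its values at the `x` of
positive probability are found by integration over `X = x`. -/
lemma condExp_indicator_eq_of_cond [IsProbabilityMeasure P] {X U : Ω → ℕ} (hX : Measurable X)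
    (hU : Measurable U) {κ : ℕ → Measure ℕ}
    (h : ∀ x, P (X ⁻¹' {x}) ≠ 0 → (cond P (X ⁻¹' {x})).map U = κ x) (u : ℕ) :
    P[(U ⁻¹' {u}).indicator fun _ => (1 : ℝ) | MeasurableSpace.comap X ⊤] =ᵐ[P]
      fun ω => (κ (X ω)).real {u} := by
  have hm : MeasurableSpace.comap X ⊤ ≤ mΩ := hX.comap_le
  have hUu : MeasurableSet (U ⁻¹' {u}) := hU (measurableSet_singleton u)
  obtain ⟨η, -, hη⟩ := (stronglyMeasurable_condExp (m := MeasurableSpace.comap X ⊤) (μ := P)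
    (f := (U ⁻¹' {u}).indicator fun _ => (1 : ℝ))).exists_eq_measurable_comp
  have hval : ∀ x, P (X ⁻¹' {x}) ≠ 0 → η x = (κ x).real {u} := by
    intro x hx
    have hXx : MeasurableSet (X ⁻¹' {x}) := hX (measurableSet_singleton x)
    have hx' : P.real (X ⁻¹' {x}) ≠ 0 := by
      rwa [Ne, measureReal_eq_zero_iff]
    have e₁ : ∫ ω in X ⁻¹' {x}, η (X ω) ∂P = P.real (X ⁻¹' {x}) * η x := by
      rw [setIntegral_congr_fun hXx (g := fun _ => η x) fun ω hω => by
        rw [Set.mem_preimage, Set.mem_singleton_iff] at hω; simp only [hω]]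
      rw [setIntegral_const, smul_eq_mul]
    have e₂ : ∫ ω in X ⁻¹' {x}, η (X ω) ∂P =
        ∫ ω in X ⁻¹' {x}, (U ⁻¹' {u}).indicator (fun _ => (1 : ℝ)) ω ∂P := by
      rw [← setIntegral_condExp hm (μ := P) (f := (U ⁻¹' {u}).indicator fun _ => (1 : ℝ))
        ((integrable_const 1).indicator hUu) ⟨{x}, trivial, rfl⟩, hη]
      rfl
    rw [setIntegral_indicator hUu, setIntegral_const, smul_eq_mul, mul_one, e₁] at e₂
    rw [← h x hx, map_measureReal_apply hU (measurableSet_singleton u), measureReal_def,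
      cond_apply hXx, ENNReal.toReal_mul, ENNReal.toReal_inv, ← measureReal_def, ← measureReal_def,
      ← e₂, inv_mul_cancel_left₀ hx']
  have hae : ∀ᵐ ω ∂P, ∀ x, P (X ⁻¹' {x}) = 0 → X ω ≠ x := by
    rw [ae_all_iff]
    intro x
    by_cases hx : P (X ⁻¹' {x}) = 0
    · filter_upwards [measure_eq_zero_iff_ae_notMem.1 hx] with ω hω _
      exact hω
    · exact ae_of_all _ fun _ h' => absurd h' hx
  filter_upwards [hae] with ω hω
  rw [hη]
  exact hval _ fun h0 => hω _ h0 rfl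

lemma norm_thin_le {a : ℝ} (ha0 : 0 ≤ a) (ha1 : a ≤ 1) {z : ℂ} (hz : ‖z‖ ≤ 1) :
    ‖(1 - (a : ℂ) + a * z)‖ ≤ 1 := by
  calc ‖(1 - (a : ℂ) + a * z)‖ ≤ ‖((1 - a : ℝ) : ℂ)‖ + ‖(a : ℂ) * z‖ := by
        push_cast; exact norm_add_le _ _
    _ = (1 - a) + a * ‖z‖ := by
        rw [Complex.norm_real, norm_mul, Complex.norm_real, Real.norm_of_nonneg ha0,
          Real.norm_of_nonneg (sub_nonneg.2 ha1)]
    _ ≤ 1 := by nlinarith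

namespace IsPoissonINARDecomposition

variable {a : unitInterval} {lam : ℝ≥0} {X U V : ℤ → Ω → ℕ}

lemma pastSigma_le (h : IsPoissonINARDecomposition a lam P X U V) (hX : ∀ k, Measurable (X k))
    (k : ℤ) : pastSigma U V X k ≤ mΩ :=
  sup_le (sup_le (sigmaGen_le h.measurable_U _) (sigmaGen_le h.measurable_V _)) (sigmaGen_le hX _)

/-- Given the past, `U_k = u` has the binomial probability with parameters `X_{k-1}` and `a`. -/
lemma integral_mul_indicator [IsProbabilityMeasure P]
    (h : IsPoissonINARDecomposition a lam P X U V) (hX : ∀ k, Measurable (X k)) (k : ℤ)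
    {W : Ω → ℂ} (hW : Measurable[pastSigma U V X k] W) (hW1 : ∀ ω, ‖W ω‖ ≤ 1) (u : ℕ) :
    ∫ ω, (U k ⁻¹' {u}).indicator (fun _ => (1 : ℂ)) ω * W ω ∂P =
      ∫ ω, ((binomial (X (k - 1) ω) a).real {u} : ℂ) * W ω ∂P := by
  have hXk : sigmaGen X {k - 1} ≤ mΩ := sigmaGen_le hX _
  have hm : pastSigma U V X k ⊔ sigmaGen X {k - 1} ≤ mΩ := sup_le (h.pastSigma_le hX k) hXk
  have hWm := hW.mono (le_sup_left (b := sigmaGen X {k - 1})) le_rfl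
  have hUu : MeasurableSet (U k ⁻¹' {u}) := h.measurable_U k (measurableSet_singleton u)
  have hi : Integrable ((U k ⁻¹' {u}).indicator fun _ => (1 : ℝ)) P :=
    (integrable_const 1).indicator hUu
  have hiW : Integrable (((U k ⁻¹' {u}).indicator fun _ => (1 : ℝ)) • W) P := by
    refine Integrable.mono' (integrable_const (1 : ℝ))
      (hi.aestronglyMeasurable.smul (hWm.mono hm le_rfl).aestronglyMeasurable)
      (ae_of_all _ fun ω => ?_)
    rw [Pi.smul_apply', norm_smul]
    refine mul_le_one₀ ?_ (norm_nonneg _) (hW1 ω)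
    by_cases hω : ω ∈ U k ⁻¹' {u} <;> simp [Set.indicator, hω]
  have hmt := h.markov_U k (U k ⁻¹' {u})
    (measurable_sigmaGen U (Set.mem_singleton k) (MeasurableSet.singleton u))
  have hce := condExp_indicator_eq_of_cond (hX (k - 1)) (h.measurable_U k)
    (h.binomial_U k) u
  rw [← sigmaGen_singleton] at hce
  have hpull := condExp_smul_of_aestronglyMeasurable_right hi hiW
    (m := pastSigma U V X k ⊔ sigmaGen X {k - 1}) hWm.aestronglyMeasurable
  calc ∫ ω, (U k ⁻¹' {u}).indicator (fun _ => (1 : ℂ)) ω * W ω ∂P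
      = ∫ ω, (((U k ⁻¹' {u}).indicator fun _ => (1 : ℝ)) • W) ω ∂P := by
        refine integral_congr_ae (ae_of_all _ fun ω => ?_)
        by_cases hω : ω ∈ U k ⁻¹' {u} <;> simp [Pi.smul_apply', Set.indicator, hω]
    _ = ∫ ω, (P[((U k ⁻¹' {u}).indicator fun _ => (1 : ℝ)) • W |
          pastSigma U V X k ⊔ sigmaGen X {k - 1}]) ω ∂P := (integral_condExp hm).symm
    _ = _ := by
        refine integral_congr_ae ?_
        filter_upwards [hpull, hmt, hce] with ω h₁ h₂ h₃
        rw [h₁, Pi.smul_apply', h₂, h₃, Complex.real_smul]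

/-- Binomial thinning: given the past, `U_k` has generating function
`z ↦ (1 - a + a z) ^ X_{k-1}`. -/
lemma integral_mul_pow_thinned [IsProbabilityMeasure P]
    (h : IsPoissonINARDecomposition a lam P X U V) (hX : ∀ k, Measurable (X k)) (k : ℤ)
    {W : Ω → ℂ} (hW : Measurable[pastSigma U V X k] W) (hW1 : ∀ ω, ‖W ω‖ ≤ 1) {z : ℂ}
    (hz : ‖z‖ ≤ 1) :
    ∫ ω, W ω * z ^ U k ω ∂P =
      ∫ ω, W ω * (1 - (a : ℝ) + (a : ℝ) * z) ^ X (k - 1) ω ∂P := by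
  have hWm : Measurable W := hW.mono (h.pastSigma_le hX k) le_rfl
  have hUu : ∀ u, MeasurableSet (U k ⁻¹' {u}) := fun u =>
    h.measurable_U k (measurableSet_singleton u)
  have hbm : ∀ u, Measurable fun ω => ((binomial (X (k - 1) ω) a).real {u} : ℂ) := fun u =>
    (Measurable.of_discrete (f := fun x : ℕ => ((binomial x a).real {u} : ℂ))).comp (hX (k - 1))
  -- partial sums over the values of `U_k`, on either side
  have t₁ : Tendsto (fun N => ∫ ω, ∑ u ∈ Finset.range N,
      z ^ u * ((U k ⁻¹' {u}).indicator (fun _ => (1 : ℂ)) ω * W ω) ∂P) atTop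
      (𝓝 (∫ ω, W ω * z ^ U k ω ∂P)) := by
    have val : ∀ N ω, ∑ u ∈ Finset.range N,
        z ^ u * ((U k ⁻¹' {u}).indicator (fun _ => (1 : ℂ)) ω * W ω) =
          if U k ω < N then W ω * z ^ U k ω else 0 := fun N ω => by
      have : ∀ u, z ^ u * ((U k ⁻¹' {u}).indicator (fun _ => (1 : ℂ)) ω * W ω) =
          if U k ω = u then W ω * z ^ U k ω else 0 := fun u => by
        by_cases hu : U k ω = u
        · subst hu; simp [Set.indicator]; ring
        · simp [Set.indicator, hu]
      simp_rw [this]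
      rw [Finset.sum_ite_eq]
      simp
    simp_rw [val]
    refine tendsto_integral_of_dominated_convergence (fun _ => (1 : ℝ)) (fun N => ?_)
      (integrable_const 1) (fun N => ae_of_all _ fun ω => ?_) (ae_of_all _ fun ω => ?_)
    · refine (Measurable.ite (h.measurable_U k (measurableSet_Iio (a := N))) ?_
        measurable_const).aestronglyMeasurable
      exact hWm.mul ((Measurable.of_discrete (f := fun n : ℕ => z ^ n)).comp (h.measurable_U k))
    · split_ifs
      · rw [norm_mul, norm_pow]
        exact mul_le_one₀ (hW1 ω) (by positivity) (pow_le_one₀ (norm_nonneg _) hz)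
      · simp
    · refine tendsto_const_nhds.congr' ?_
      filter_upwards [eventually_gt_atTop (U k ω)] with N hN
      rw [if_pos hN]
  have t₂ : Tendsto (fun N => ∫ ω, ∑ u ∈ Finset.range N,
      z ^ u * (((binomial (X (k - 1) ω) a).real {u} : ℂ) * W ω) ∂P) atTop
      (𝓝 (∫ ω, W ω * (1 - (a : ℝ) + (a : ℝ) * z) ^ X (k - 1) ω ∂P)) := by
    refine tendsto_integral_of_dominated_convergence (fun _ => (1 : ℝ)) (fun N => ?_)
      (integrable_const 1) (fun N => ae_of_all _ fun ω => ?_) (ae_of_all _ fun ω => ?_)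
    · exact (Finset.measurable_sum _ fun u _ =>
        ((hbm u).mul hWm).const_mul _).aestronglyMeasurable
    · refine (norm_sum_le _ _).trans (le_trans (Finset.sum_le_sum fun u _ => ?_)
        (sum_binomial_le_one a (X (k - 1) ω) N))
      rw [norm_mul, norm_mul, norm_pow, Complex.norm_real, Real.norm_of_nonneg measureReal_nonneg]
      calc ‖z‖ ^ u * ((binomial (X (k - 1) ω) a).real {u} * ‖W ω‖)
          ≤ 1 * ((binomial (X (k - 1) ω) a).real {u} * 1) := by
            gcongr
            · exact pow_le_one₀ (norm_nonneg _) hz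
            · exact hW1 ω
        _ = _ := by ring
    · refine tendsto_const_nhds.congr' ?_
      filter_upwards [eventually_gt_atTop (X (k - 1) ω)] with N hN
      rw [← sum_binomial_mul_pow a _ N hN, Finset.mul_sum]
      exact Finset.sum_congr rfl fun u _ => by ring
  refine tendsto_nhds_unique t₁ (t₂.congr fun N => ?_)
  have i₁ : ∀ u, Integrable (fun ω => z ^ u *
      (((binomial (X (k - 1) ω) a).real {u} : ℂ) * W ω)) P := fun u => by
    have hme : Measurable fun ω => ((binomial (X (k - 1) ω) a).real {u} : ℂ) * W ω :=
      (hbm u).mul hWm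
    refine Integrable.const_mul (Integrable.mono' (integrable_const (1 : ℝ))
      hme.aestronglyMeasurable (ae_of_all _ fun ω => ?_)) _
    rw [norm_mul, Complex.norm_real, Real.norm_of_nonneg measureReal_nonneg]
    exact mul_le_one₀ measureReal_le_one (norm_nonneg _) (hW1 ω)
  have i₂ : ∀ u, Integrable (fun ω => z ^ u *
      ((U k ⁻¹' {u}).indicator (fun _ => (1 : ℂ)) ω * W ω)) P := fun u => by
    have hme : Measurable fun ω => (U k ⁻¹' {u}).indicator (fun _ => (1 : ℂ)) ω * W ω :=
      (measurable_const.indicator (hUu u)).mul hWm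
    refine Integrable.const_mul (Integrable.mono' (integrable_const (1 : ℝ))
      hme.aestronglyMeasurable (ae_of_all _ fun ω => ?_)) _
    rw [norm_mul]
    refine mul_le_one₀ ?_ (norm_nonneg _) (hW1 ω)
    by_cases hω : ω ∈ U k ⁻¹' {u} <;> simp [Set.indicator, hω]
  rw [integral_finsetSum _ fun u _ => i₁ u, integral_finsetSum _ fun u _ => i₂ u]
  refine Finset.sum_congr rfl fun u _ => ?_
  rw [integral_const_mul, integral_const_mul, h.integral_mul_indicator hX k hW hW1 u]

/-- One step of the INAR(1) recursion, for generating functions. -/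
lemma integral_mul_pow_step [IsProbabilityMeasure P]
    (h : IsPoissonINARDecomposition a lam P X U V) (hX : ∀ k, Measurable (X k)) (k : ℤ)
    {W : Ω → ℂ} (hW : Measurable[pastSigma U V X k] W) (hW1 : ∀ ω, ‖W ω‖ ≤ 1) {z : ℂ}
    (hz : ‖z‖ ≤ 1) :
    ∫ ω, W ω * z ^ X k ω ∂P = Complex.exp ((lam : ℝ) * (z - 1)) *
      ∫ ω, W ω * (1 - (a : ℝ) + (a : ℝ) * z) ^ X (k - 1) ω ∂P := by
  have hpast := h.pastSigma_le hX k
  have hzm : ∀ Z : Ω → ℕ, ∀ m : MeasurableSpace Ω, Measurable[m] Z →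
      Measurable[m] fun ω => z ^ Z ω := fun Z m hZ =>
    (Measurable.of_discrete (f := fun n : ℕ => z ^ n)).comp hZ
  have hV : ∫ ω, z ^ V k ω ∂P = Complex.exp ((lam : ℝ) * (z - 1)) := by
    rw [← integral_pow_poissonMeasure, ← h.poisson_V k, integral_map
      (h.measurable_V k).aemeasurable (Measurable.of_discrete).aestronglyMeasurable]
  have hind : IndepFun (fun ω => W ω * z ^ U k ω) (fun ω => z ^ V k ω) P := by
    refine (IndepFun_iff_Indep _ _ _).2 (indep_of_indep_of_le_left
      (indep_of_indep_of_le_right (h.indep_V k).symm ?_) ?_)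
    · exact measurable_iff_comap_le.1
        (hzm _ _ (measurable_sigmaGen V (Set.mem_singleton k)))
    · refine measurable_iff_comap_le.1 (Measurable.mul (hW.mono le_sup_left le_rfl) ?_)
      exact hzm _ _ ((measurable_sigmaGen U (Set.mem_singleton k)).mono le_sup_right le_rfl)
  calc ∫ ω, W ω * z ^ X k ω ∂P = ∫ ω, (W ω * z ^ U k ω) * z ^ V k ω ∂P := by
        refine integral_congr_ae ?_
        filter_upwards [h.eq_add k] with ω hω
        rw [hω, pow_add, mul_assoc]
    _ = (∫ ω, W ω * z ^ U k ω ∂P) * ∫ ω, z ^ V k ω ∂P :=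
        hind.integral_fun_mul_eq_mul_integral
          ((hW.mono hpast le_rfl).mul (hzm _ _ (h.measurable_U k))).aestronglyMeasurable
          (hzm _ _ (h.measurable_V k)).aestronglyMeasurable
    _ = _ := by rw [hV, h.integral_mul_pow_thinned hX k hW hW1 hz, mul_comm]

end IsPoissonINARDecomposition

lemma IsStrictlyStationary.integral_eq {X : ℤ → Ω → ℕ} (h : IsStrictlyStationary P X)
    (hX : ∀ k, Measurable (X k)) (φ : ℕ → ℂ) (k l : ℤ) :
    ∫ ω, φ (X k ω) ∂P = ∫ ω, φ (X l ω) ∂P := by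
  have key : ∀ k : ℤ, ∫ ω, φ (X k ω) ∂P = ∫ ω, φ (X 0 ω) ∂P := fun k => by
    have hφ : ∀ μ : Measure (ℤ → ℕ), AEStronglyMeasurable (fun x : ℤ → ℕ => φ (x 0)) μ := fun μ =>
      ((Measurable.of_discrete (f := φ)).comp (measurable_pi_apply 0)).aestronglyMeasurable
    have e := congrArg (fun μ => ∫ x : ℤ → ℕ, φ (x 0) ∂μ) (h k)
    rw [integral_map (measurable_pi_lambda _ fun j => hX _).aemeasurable (hφ _),
      integral_map (measurable_pi_lambda _ fun j => hX _).aemeasurable (hφ _)] at e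
    simpa using e
  rw [key k, key l]

/-- The marginal law is Poisson with mean `lam / (1 - a)`. By stationarity its generating function
`G` satisfies `G(1 - w) = exp (- lam w) G(1 - a w)`, and iteration of this leads to `G(1) = 1`. -/
lemma integral_pow_marginal [IsProbabilityMeasure P] {a : unitInterval} {lam : ℝ≥0}
    {X U V : ℤ → Ω → ℕ} (h : IsPoissonINARDecomposition a lam P X U V)
    (hX : ∀ k, Measurable (X k)) (hst : IsStrictlyStationary P X) (ha1 : (a : ℝ) < 1) (k : ℤ)
    {z : ℂ} (hz : ‖z‖ ≤ 1) :
    ∫ ω, z ^ X k ω ∂P = Complex.exp ((lam : ℝ) * (((1 - (a : ℝ))⁻¹ : ℝ) * (z - 1))) := by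
  have ha0 : 0 ≤ (a : ℝ) := a.2.1
  have ha1' : ((1 - (a : ℝ) : ℝ) : ℂ) ≠ 0 := Complex.ofReal_ne_zero.2 (sub_pos.2 ha1).ne'
  have ptn : ∀ n : ℕ, ‖(1 - ((a : ℝ) ^ n : ℝ) + ((a : ℝ) ^ n : ℝ) * z : ℂ)‖ ≤ 1 := fun n =>
    norm_thin_le (pow_nonneg ha0 n) (pow_le_one₀ ha0 ha1.le) hz
  have iter : ∀ n : ℕ, ∫ ω, z ^ X k ω ∂P =
      Complex.exp ((lam : ℝ) * (((1 - (a : ℝ))⁻¹ : ℝ) * ((1 - ((a : ℝ) ^ n : ℝ)) * (z - 1)))) *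
        ∫ ω, (1 - ((a : ℝ) ^ n : ℝ) + ((a : ℝ) ^ n : ℝ) * z : ℂ) ^ X k ω ∂P := by
    intro n
    induction n with
    | zero => simp
    | succ n ih =>
      have hs := h.integral_mul_pow_step hX k (W := fun _ => 1) measurable_const (by simp) (ptn n)
      simp only [one_mul] at hs
      rw [ih, hs, hst.integral_eq hX _ (k - 1) k, ← mul_assoc, ← Complex.exp_add]
      congr 2
      · push_cast at ha1' ⊢
        field_simp
        ring
      · funext ω
        congr 1
        push_cast
        ring
  have hpow : Tendsto (fun n : ℕ => (((a : ℝ) ^ n : ℝ) : ℂ)) atTop (𝓝 0) := by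
    rw [← Complex.ofReal_zero]
    exact (Complex.continuous_ofReal.tendsto 0).comp
      (tendsto_pow_atTop_nhds_zero_of_lt_one ha0 ha1)
  have lim₁ : Tendsto (fun n : ℕ =>
      ∫ ω, (1 - ((a : ℝ) ^ n : ℝ) + ((a : ℝ) ^ n : ℝ) * z : ℂ) ^ X k ω ∂P) atTop
      (𝓝 (∫ _, (1 : ℂ) ∂P)) := by
    refine tendsto_integral_of_dominated_convergence (fun _ => (1 : ℝ)) (fun n => ?_)
      (integrable_const 1) (fun n => ae_of_all _ fun ω => ?_) (ae_of_all _ fun ω => ?_)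
    · exact ((Measurable.of_discrete (f := fun m : ℕ =>
        (1 - ((a : ℝ) ^ n : ℝ) + ((a : ℝ) ^ n : ℝ) * z : ℂ) ^ m)).comp (hX k)).aestronglyMeasurable
    · rw [norm_pow]
      exact pow_le_one₀ (norm_nonneg _) (ptn n)
    · have := (((tendsto_const_nhds (x := (1 : ℂ))).sub hpow).add
        (hpow.mul_const z)).pow (X k ω)
      simpa using this
  have lim₂ : Tendsto (fun n : ℕ =>
      Complex.exp ((lam : ℝ) * (((1 - (a : ℝ))⁻¹ : ℝ) * ((1 - ((a : ℝ) ^ n : ℝ)) * (z - 1)))))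
      atTop (𝓝 (Complex.exp ((lam : ℝ) * (((1 - (a : ℝ))⁻¹ : ℝ) * (z - 1))))) := by
    refine (Complex.continuous_exp.tendsto _).comp (Tendsto.const_mul _ (Tendsto.const_mul _ ?_))
    simpa using ((tendsto_const_nhds (x := (1 : ℂ))).sub hpow).mul_const (z - 1)
  have := lim₂.mul lim₁
  rw [integral_const, probReal_univ, one_smul, mul_one] at this
  exact tendsto_nhds_unique (tendsto_const_nhds.congr iter) this

/-- The contribution of the particles that are last alive at time `j` to the exponent of the
generating function, without the factor for the time of death. -/
noncomputable def birthSum (a : ℝ) (j : ℕ) (z : ℕ → ℂ) : ℂ :=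
  ∑ i ∈ Finset.range (j + 1), (birthWeight a i : ℂ) * (∏ k ∈ Finset.Icc i j, z k - 1)

/-- The exponent of the generating function of the process on the window `{0, …, M}`. -/
noncomputable def windowExponent (a : ℝ) (M : ℕ) (z : ℕ → ℂ) : ℂ :=
  ∑ j ∈ Finset.range (M + 1), (deathWeight a M j : ℂ) * birthSum a j z

lemma birthSum_congr {a : ℝ} {j : ℕ} {z z' : ℕ → ℂ} (h : ∀ k ≤ j, z k = z' k) :
    birthSum a j z = birthSum a j z' := by
  refine Finset.sum_congr rfl fun i _ => ?_
  rw [Finset.prod_congr rfl fun k hk => h k (Finset.mem_Icc.1 hk).2]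

lemma windowExponent_eq (a : ℝ) (M : ℕ) (z : ℕ → ℂ) :
    windowExponent a M z =
      ∑ j ∈ Finset.range M, ((1 - a) * a ^ j : ℂ) * birthSum a j z + a ^ M * birthSum a M z := by
  rw [windowExponent, Finset.sum_range_succ]
  congr 1
  · refine Finset.sum_congr rfl fun j hj => ?_
    rw [deathWeight, if_pos (Finset.mem_range.1 hj)]
    push_cast
    rfl
  · rw [deathWeight, if_neg (lt_irrefl _)]
    push_cast
    rfl

/-- The recursion for the exponent: thinning the last coordinate of the window produces the
particles which survive one more time step. -/
lemma windowExponent_succ {a : ℝ} (ha0 : 0 < a) (M : ℕ) (z : ℕ → ℂ) :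
    windowExponent a (M + 1) z = (z (M + 1) - 1) +
      windowExponent a M (Function.update z M (z M * (1 - a + a * z (M + 1)))) := by
  have ha : (a : ℂ) ≠ 0 := Complex.ofReal_ne_zero.2 ha0.ne'
  set z' := Function.update z M (z M * (1 - a + a * z (M + 1))) with hz'
  rw [windowExponent_eq, windowExponent_eq, Finset.sum_range_succ]
  have e₁ : ∑ j ∈ Finset.range M, ((1 - a) * a ^ j : ℂ) * birthSum a j z' =
      ∑ j ∈ Finset.range M, ((1 - a) * a ^ j : ℂ) * birthSum a j z := by
    refine Finset.sum_congr rfl fun j hj => ?_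
    rw [birthSum_congr (z := z') (z' := z) fun k hk => ?_]
    have := Finset.mem_range.1 hj
    rw [hz', Function.update_of_ne (by omega)]
  set R : ℂ := ∑ i ∈ Finset.range (M + 1),
    (birthWeight a i : ℂ) * (∏ k ∈ Finset.Icc i (M + 1), z k - 1) with hR
  have e₂ : birthSum a (M + 1) z = R + (a : ℂ)⁻¹ ^ (M + 1) * (z (M + 1) - 1) := by
    rw [birthSum, Finset.sum_range_succ, Finset.Icc_self, Finset.prod_singleton, birthWeight,
      if_neg (Nat.succ_ne_zero M)]
    push_cast
    rfl
  have e₃ : birthSum a M z' = (1 - a) * birthSum a M z + a * R := by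
    rw [birthSum, birthSum, hR, Finset.mul_sum, Finset.mul_sum, ← Finset.sum_add_distrib]
    refine Finset.sum_congr rfl fun i hi => ?_
    have hiM : i ≤ M := Nat.lt_succ_iff.1 (Finset.mem_range.1 hi)
    have p₁ : ∏ k ∈ Finset.Icc i (M + 1), z k = (∏ k ∈ Finset.Icc i M, z k) * z (M + 1) :=
      Finset.prod_Icc_succ_top (by omega) _
    have p₂ : ∏ k ∈ Finset.Icc i M, z' k =
        (∏ k ∈ Finset.Icc i M, z k) * (1 - a + a * z (M + 1)) := by
      have hM : M ∈ Finset.Icc i M := Finset.mem_Icc.2 ⟨hiM, le_rfl⟩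
      rw [hz', Finset.prod_update_of_mem hM, Finset.prod_eq_mul_prod_sdiff_singleton_of_mem hM]
      ring
    rw [p₁, p₂]
    ring
  rw [e₁, e₂, e₃, mul_add, ← mul_assoc ((a : ℂ) ^ (M + 1)), ← mul_pow, mul_inv_cancel₀ ha,
    one_pow]
  ring

/-- The generating function of `(X_{k₀}, …, X_{k₀ + M})` is that of a superposition of
independent Poisson numbers of particles living on the intervals of the window. -/
lemma integral_prod_pow [IsProbabilityMeasure P] {a : unitInterval} {lam : ℝ≥0}
    {X U V : ℤ → Ω → ℕ} (h : IsPoissonINARDecomposition a lam P X U V)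
    (hX : ∀ k, Measurable (X k)) (hst : IsStrictlyStationary P X) (ha0 : 0 < (a : ℝ))
    (ha1 : (a : ℝ) < 1) (k₀ : ℤ) (M : ℕ) (z : ℕ → ℂ) (hz : ∀ j, ‖z j‖ ≤ 1) :
    ∫ ω, ∏ j ∈ Finset.range (M + 1), z j ^ X (k₀ + j) ω ∂P =
      Complex.exp ((lam : ℝ) * windowExponent a M z) := by
  induction M generalizing z with
  | zero =>
    have := integral_pow_marginal h hX hst ha1 k₀ (hz 0)
    simpa [windowExponent, birthSum, birthWeight, deathWeight] using this
  | succ M ih =>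
    set z' := Function.update z M (z M * (1 - (a : ℝ) + (a : ℝ) * z (M + 1))) with hz'
    have hz'1 : ∀ j, ‖z' j‖ ≤ 1 := fun j => by
      by_cases hj : j = M
      · subst hj
        rw [hz', Function.update_self, norm_mul]
        exact mul_le_one₀ (hz j) (norm_nonneg _) (norm_thin_le a.2.1 a.2.2 (hz _))
      · rw [hz', Function.update_of_ne hj]
        exact hz j
    have hk : k₀ + ((M + 1 : ℕ) : ℤ) - 1 = k₀ + M := by push_cast; ring
    have hW : Measurable[pastSigma U V X (k₀ + ((M + 1 : ℕ) : ℤ))]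
        fun ω => ∏ j ∈ Finset.range (M + 1), z j ^ X (k₀ + j) ω := by
      refine Finset.measurable_prod _ fun j hj => ?_
      refine (Measurable.of_discrete (f := fun n : ℕ => z j ^ n)).comp
        ((measurable_sigmaGen X ?_).mono le_sup_right le_rfl)
      have := Finset.mem_range.1 hj
      rw [hk, Set.mem_Iic]
      omega
    have hW1 : ∀ ω, ‖∏ j ∈ Finset.range (M + 1), z j ^ X (k₀ + j) ω‖ ≤ 1 := fun ω => by
      rw [norm_prod]
      refine Finset.prod_le_one (fun j _ => norm_nonneg _) fun j _ => ?_
      rw [norm_pow]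
      exact pow_le_one₀ (norm_nonneg _) (hz j)
    have hs := h.integral_mul_pow_step hX _ hW hW1 (hz (M + 1))
    rw [hk] at hs
    simp_rw [Finset.prod_range_succ _ (M + 1)]
    rw [hs, windowExponent_succ ha0, mul_add, Complex.exp_add, ← ih z' hz'1]
    congr 1
    refine integral_congr_ae (ae_of_all _ fun ω => ?_)
    dsimp only
    rw [Finset.prod_range_succ, Finset.prod_range_succ, hz', Function.update_self, mul_pow,
      mul_assoc]
    congr 1
    refine Finset.prod_congr rfl fun j hj => ?_
    rw [Function.update_of_ne (Finset.mem_range.1 hj).ne]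

/-- The exponent as a sum over all pairs of end points. -/
lemma windowExponent_eq_sum_particleWeight (a lam : ℝ) (M : ℕ) (z : ℕ → ℂ) :
    (lam : ℂ) * windowExponent a M z = ∑ y : Fin (M + 1) × Fin (M + 1),
      (particleWeight a lam y : ℂ) *
        (∏ k : Fin (M + 1), z k ^ intervalTrace Finset.univ y k - 1) := by
  have hprod : ∀ i j : Fin (M + 1), (∏ k : Fin (M + 1), z k ^ intervalTrace Finset.univ (i, j) k) =
      ∏ k ∈ Finset.Icc (i : ℕ) j, z k := fun i j => by
    have : ∀ k : Fin (M + 1), z k ^ intervalTrace Finset.univ (i, j) k =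
        if (k : ℕ) ∈ Finset.Icc (i : ℕ) j then z k else 1 := fun k => by
      simp only [intervalTrace, Finset.mem_univ, true_and, Finset.mem_Icc, Fin.le_def]
      split_ifs <;> simp
    simp_rw [this]
    rw [Fin.prod_univ_eq_prod_range (fun k => if k ∈ Finset.Icc (i : ℕ) j then z k else 1),
      Finset.prod_ite_mem]
    congr 1
    ext k
    simp only [Finset.mem_inter, Finset.mem_range, Finset.mem_Icc]
    omega
  rw [windowExponent, Fintype.sum_prod_type_right,
    ← Fin.sum_univ_eq_sum_range (fun j => (deathWeight a M j : ℂ) * birthSum a j z), Finset.mul_sum]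
  refine Finset.sum_congr rfl fun j _ => ?_
  have hb : birthSum a j z = ∑ i : Fin (M + 1),
      (birthWeight a i : ℂ) * (∏ k ∈ Finset.Icc (i : ℕ) j, z k - 1) := by
    rw [Fin.sum_univ_eq_sum_range (fun i => (birthWeight a i : ℂ) *
      (∏ k ∈ Finset.Icc i (j : ℕ), z k - 1)), birthSum]
    refine Finset.sum_subset (Finset.range_subset_range.2 (by omega)) fun i _ hi => ?_
    rw [Finset.mem_range, not_lt] at hi
    rw [Finset.Icc_eq_empty (by omega), Finset.prod_empty, sub_self, mul_zero]
  rw [hb, Finset.mul_sum, Finset.mul_sum]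
  refine Finset.sum_congr rfl fun i _ => ?_
  rw [hprod, particleWeight]
  push_cast
  ring

/-! ### The Poisson limit of sums of rare particles -/

/-- The law of `x y` when `y` is chosen with the weights `q`. -/
noncomputable def finiteLaw {Y E : Type*} [Fintype Y] [MeasurableSpace E] (q : Y → ℝ) (x : Y → E) :
    Measure E :=
  ∑ y, ENNReal.ofReal (q y) • Measure.dirac (x y)

section FiniteLaw

variable {Y E G : Type*} [Fintype Y] [MeasurableSpace E] [NormedAddCommGroup G] [NormedSpace ℝ G]
  [CompleteSpace G]

lemma integral_finiteLaw {q : Y → ℝ} (hq : ∀ y, 0 ≤ q y) (x : Y → E) {F : E → G}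
    (hF : StronglyMeasurable F) : ∫ e, F e ∂(finiteLaw q x) = ∑ y, q y • F (x y) := by
  rw [finiteLaw, integral_finsetSum_measure]
  · refine Finset.sum_congr rfl fun y _ => ?_
    rw [integral_smul_measure, integral_dirac' _ _ hF, ENNReal.toReal_ofReal (hq y)]
  · intro y _
    exact (integrable_dirac' hF (by simp)).smul_measure ENNReal.ofReal_ne_top

lemma isProbabilityMeasure_finiteLaw {q : Y → ℝ} (hq : ∀ y, 0 ≤ q y) (h1 : ∑ y, q y = 1)
    (x : Y → E) : IsProbabilityMeasure (finiteLaw q x) := by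
  refine ⟨?_⟩
  rw [finiteLaw, Measure.finsetSum_apply]
  simp only [Measure.smul_apply, measure_univ, smul_eq_mul, mul_one]
  rw [← ENNReal.ofReal_sum_of_nonneg fun y _ => hq y, h1, ENNReal.ofReal_one]

end FiniteLaw

section Limit

variable {ι Y : Type*} [Fintype ι] [Fintype Y]

/-- The inclusion of `ℕ ^ ι` into Euclidean space. -/
noncomputable def natEmb (x : ι → ℕ) : EuclideanSpace ℝ ι := WithLp.toLp 2 fun k => (x k : ℝ)

lemma isClosedEmbedding_natEmb {ι : Type*} :
    Topology.IsClosedEmbedding (natEmb : (ι → ℕ) → EuclideanSpace ℝ ι) :=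
  (PiLp.homeomorph 2 fun _ : ι => ℝ).symm.isClosedEmbedding.comp
    (Topology.IsClosedEmbedding.piMap fun _ : ι => Nat.isClosedEmbedding_coe_real)

lemma exp_inner_natEmb (x : ι → ℕ) (t : EuclideanSpace ℝ ι) :
    Complex.exp ((inner ℝ (natEmb x) t : ℝ) * Complex.I) =
      ∏ k, Complex.exp (t k * Complex.I) ^ x k := by
  simp_rw [← Complex.exp_nat_mul]
  rw [← Complex.exp_sum, PiLp.inner_apply]
  congr 1
  push_cast
  rw [Finset.sum_mul]
  refine Finset.sum_congr rfl fun k _ => ?_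
  simp [natEmb]
  ring

/-- The trace of a possibly absent particle; the absent one leaves none. -/
def optionTrace (ξ : Y → ι → ℕ) : Option Y → ι → ℕ
  | none => 0
  | some y => ξ y

lemma sum_rareWeight_mul_prod (w : Y → ℝ) (ξ : Y → ι → ℕ) (m : ℝ) (z : ι → ℂ) :
    ∑ y, (rareWeight w m y : ℂ) * ∏ k, z k ^ optionTrace ξ y k =
      1 + (∑ y, (w y : ℂ) * (∏ k, z k ^ ξ y k - 1)) / m := by
  rw [Fintype.sum_option]
  simp only [rareWeight, optionTrace, Pi.zero_apply, pow_zero, Finset.prod_const_one, mul_one]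
  push_cast
  simp only [mul_sub, mul_one, Finset.sum_sub_distrib, div_mul_eq_mul_div, ← Finset.sum_div]
  ring

lemma charFun_sum_rare {w : Y → ℝ} (hw : ∀ y, 0 ≤ w y) (ξ : Y → ι → ℕ) {m : ℕ} (hm : 0 < m)
    (hwm : ∑ y, w y ≤ m) (t : EuclideanSpace ℝ ι) :
    charFun (finiteLaw (wpi (rareWeight w m) m)
      fun y : Fin m → Option Y => natEmb (∑ l, optionTrace ξ (y l))) t =
      (1 + (∑ y, (w y : ℂ) * (∏ k, Complex.exp (t k * Complex.I) ^ ξ y k - 1)) / m) ^ m := by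
  rw [charFun_apply, integral_finiteLaw (wpi_nonneg (rareWeight_nonneg hw (by exact_mod_cast hm)
    hwm) m) _ (Continuous.stronglyMeasurable (by fun_prop))]
  have := sum_rareWeight_mul_prod w ξ m fun k => Complex.exp (t k * Complex.I)
  rw [Complex.ofReal_natCast] at this
  rw [← this, ← sum_wpi_mul_prod]
  refine Finset.sum_congr rfl fun y _ => ?_
  rw [exp_inner_natEmb, Complex.real_smul, wpi, Complex.ofReal_prod, Finset.prod_mul_distrib,
    Finset.prod_comm]
  congr 1
  refine Finset.prod_congr rfl fun k _ => ?_
  rw [Finset.prod_pow_eq_pow_sum, Finset.sum_apply]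

/-- A random vector whose generating function is that of a superposition of Poisson numbers of
particles is the limit in law of sums of `m` independent rare particles, as `m → ∞`. Since the
state space is discrete, all bounded functions are admissible as test functions. -/
lemma tendsto_wmean_sum_rare [IsProbabilityMeasure P] {w : Y → ℝ} (hw : ∀ y, 0 ≤ w y)
    (ξ : Y → ι → ℕ) {Z : Ω → ι → ℕ} (hZ : Measurable Z)
    (hgf : ∀ z : ι → ℂ, (∀ k, ‖z k‖ ≤ 1) → ∫ ω, ∏ k, z k ^ Z ω k ∂P =
      Complex.exp (∑ y, (w y : ℂ) * (∏ k, z k ^ ξ y k - 1)))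
    {φ : (ι → ℕ) → ℝ} {C : ℝ} (hφ : ∀ x, |φ x| ≤ C) :
    Tendsto (fun m : ℕ => wmean (wpi (rareWeight w m) m)
      fun y : Fin m → Option Y => φ (∑ l, optionTrace ξ (y l))) atTop (𝓝 (∫ ω, φ (Z ω) ∂P)) := by
  obtain ⟨n₀, hn₀⟩ := exists_nat_ge (∑ y, w y)
  rw [← tendsto_add_atTop_iff_nat (n₀ + 1)]
  have hm : ∀ n : ℕ, ∑ y, w y ≤ ((n + (n₀ + 1) : ℕ) : ℝ) := fun n =>
    hn₀.trans (by push_cast; linarith [n.cast_nonneg (α := ℝ)])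
  have hnn : ∀ (n : ℕ) (y : Fin (n + (n₀ + 1)) → Option Y),
      0 ≤ wpi (rareWeight w ((n + (n₀ + 1) : ℕ) : ℝ)) (n + (n₀ + 1)) y := fun n =>
    wpi_nonneg (rareWeight_nonneg hw (by positivity) (hm n)) _
  have hZe : Measurable fun ω => natEmb (Z ω) :=
    (isClosedEmbedding_natEmb.continuous.measurable).comp hZ
  have : IsProbabilityMeasure (P.map fun ω => natEmb (Z ω)) :=
    Measure.isProbabilityMeasure_map hZe.aemeasurable
  set μ₀ : ProbabilityMeasure (EuclideanSpace ℝ ι) := ⟨P.map fun ω => natEmb (Z ω), this⟩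
  set μ : ℕ → ProbabilityMeasure (EuclideanSpace ℝ ι) := fun n =>
    ⟨finiteLaw (wpi (rareWeight w ((n + (n₀ + 1) : ℕ) : ℝ)) (n + (n₀ + 1)))
      fun y : Fin (n + (n₀ + 1)) → Option Y => natEmb (∑ l, optionTrace ξ (y l)),
      isProbabilityMeasure_finiteLaw (hnn n) (sum_wpi (sum_rareWeight _ _) _) _⟩ with hμ
  have hlim : Tendsto μ atTop (𝓝 μ₀) := by
    refine ProbabilityMeasure.tendsto_of_tendsto_charFun fun t => ?_
    have e₀ : charFun (μ₀ : Measure (EuclideanSpace ℝ ι)) t =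
        Complex.exp (∑ y, (w y : ℂ) * (∏ k, Complex.exp (t k * Complex.I) ^ ξ y k - 1)) := by
      rw [← hgf _ fun k => (Complex.norm_exp_ofReal_mul_I (t k)).le]
      change charFun (P.map fun ω => natEmb (Z ω)) t = _
      rw [charFun_apply, integral_map hZe.aemeasurable
        (Continuous.stronglyMeasurable (by fun_prop)).aestronglyMeasurable]
      simp_rw [exp_inner_natEmb]
    rw [e₀]
    refine ((Complex.tendsto_one_add_div_pow_exp _).comp
      (tendsto_add_atTop_nat (n₀ + 1))).congr fun n => ?_
    exact (charFun_sum_rare hw ξ (Nat.succ_pos _) (hm n) t).symm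
  -- a function on the lattice extends to a bounded continuous function on Euclidean space
  obtain ⟨g, -, hg⟩ := BoundedContinuousFunction.exists_extension_norm_eq_of_isClosedEmbedding
    (BoundedContinuousFunction.ofNormedAddCommGroup φ continuous_of_discreteTopology C hφ)
    isClosedEmbedding_natEmb
  have hg' : ∀ x, g (natEmb x) = φ x := fun x => congrFun hg x
  have hint := ProbabilityMeasure.tendsto_iff_forall_integral_tendsto.1 hlim g
  have e₀ : ∫ e, g e ∂(μ₀ : Measure (EuclideanSpace ℝ ι)) = ∫ ω, φ (Z ω) ∂P := by
    change ∫ e, g e ∂(P.map fun ω => natEmb (Z ω)) = _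
    rw [integral_map hZe.aemeasurable g.continuous.stronglyMeasurable.aestronglyMeasurable]
    simp_rw [hg']
  rw [e₀] at hint
  refine hint.congr fun n => ?_
  change ∫ e, g e ∂(finiteLaw _ _) = _
  rw [integral_finiteLaw (hnn n) _ g.continuous.stronglyMeasurable]
  simp_rw [hg']
  rfl

end Limit

/-! ### Correlations of bounded functions of a finite window -/

/-- The correlation of `f` and `g` is at most `ρ`, written without a quotient. -/
def CorrLE (P : Measure Ω) (f g : Ω → ℝ) (ρ : ℝ) : Prop :=
  |covariance f g P| ≤ ρ * (√(variance f P) * √(variance g P))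

lemma memLp_of_abs_le [IsFiniteMeasure P] {f : Ω → ℝ} (hf : Measurable f) {C : ℝ}
    (hC : ∀ ω, |f ω| ≤ C) : MemLp f 2 P :=
  MemLp.of_bound hf.aestronglyMeasurable C (ae_of_all _ hC)

/-- The maximal correlation of the superposition is bounded by the uncentred correlation of a single
particle: this is the Poisson limit of the Csáki–Fisher theorem. Here `A` and `B` are the traces of
a particle which `f` and `g` depend on. -/
lemma corrLE_of_poisson_superposition [IsProbabilityMeasure P] {ι Y : Type*} [Fintype ι]
    [Fintype Y] {w : Y → ℝ} (hw : ∀ y, 0 ≤ w y) (ξ A B : Y → ι → ℕ) {Z : Ω → ι → ℕ}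
    (hZ : Measurable Z)
    (hgf : ∀ z : ι → ℂ, (∀ k, ‖z k‖ ≤ 1) → ∫ ω, ∏ k, z k ^ Z ω k ∂P =
      Complex.exp (∑ y, (w y : ℂ) * (∏ k, z k ^ ξ y k - 1)))
    {κ : ℝ} (hκ : 0 ≤ κ)
    (h : ∀ f g : (ι → ℕ) → ℝ, f 0 = 0 → g 0 = 0 → |∑ y, w y * (f (A y) * g (B y))| ≤
      κ * (√(∑ y, w y * f (A y) ^ 2) * √(∑ y, w y * g (B y) ^ 2)))
    {f g : (ι → ℕ) → ℝ} {C D : ℝ} (hC : ∀ x, |f x| ≤ C) (hD : ∀ x, |g x| ≤ D)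
    (hfA : ∀ (m : ℕ) (y : Fin m → Option Y),
      f (∑ l, optionTrace ξ (y l)) = f (∑ l, optionTrace A (y l)))
    (hgB : ∀ (m : ℕ) (y : Fin m → Option Y),
      g (∑ l, optionTrace ξ (y l)) = g (∑ l, optionTrace B (y l))) :
    CorrLE P (fun ω => f (Z ω)) (fun ω => g (Z ω)) κ := by
  set Λ := ∑ y, w y
  have hΛ0 : 0 ≤ Λ := Finset.sum_nonneg fun y _ => hw y
  have hm_f : Measurable fun ω => f (Z ω) := (Measurable.of_discrete (f := f)).comp hZ
  have hm_g : Measurable fun ω => g (Z ω) := (Measurable.of_discrete (f := g)).comp hZ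
  have lim : ∀ {φ ψ : (ι → ℕ) → ℝ} {K L : ℝ}, (∀ x, |φ x| ≤ K) → (∀ x, |ψ x| ≤ L) →
      Tendsto (fun m : ℕ => wcov (wpi (rareWeight w m) m)
        (fun y : Fin m → Option Y => φ (∑ l, optionTrace ξ (y l)))
        (fun y => ψ (∑ l, optionTrace ξ (y l)))) atTop
        (𝓝 (covariance (fun ω => φ (Z ω)) (fun ω => ψ (Z ω)) P)) := by
    intro φ ψ K L hK hL
    have hmφ : Measurable fun ω => φ (Z ω) := (Measurable.of_discrete (f := φ)).comp hZ
    have hmψ : Measurable fun ω => ψ (Z ω) := (Measurable.of_discrete (f := ψ)).comp hZ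
    rw [covariance_eq_sub (memLp_of_abs_le hmφ fun ω => hK _) (memLp_of_abs_le hmψ fun ω => hL _)]
    refine Tendsto.sub ?_ (Tendsto.mul ?_ ?_)
    · exact tendsto_wmean_sum_rare hw ξ hZ hgf (φ := fun x => φ x * ψ x) (C := K * L) fun x => by
        rw [abs_mul]
        exact mul_le_mul (hK x) (hL x) (abs_nonneg _) ((abs_nonneg _).trans (hK x))
    · exact tendsto_wmean_sum_rare hw ξ hZ hgf hK
    · exact tendsto_wmean_sum_rare hw ξ hZ hgf hL
  have hε : Tendsto (fun m : ℕ => Λ / m) atTop (𝓝 0) :=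
    tendsto_const_nhds.div_atTop tendsto_natCast_atTop_atTop
  have hρ : Tendsto (fun m : ℕ => (κ + Λ / m) / (1 - Λ / m)) atTop (𝓝 κ) := by
    have := (hε.const_add κ).div (hε.const_sub 1) (by norm_num)
    rwa [add_zero, sub_zero, div_one] at this
  have bound : ∀ᶠ m : ℕ in atTop, |wcov (wpi (rareWeight w m) m)
        (fun y : Fin m → Option Y => f (∑ l, optionTrace ξ (y l)))
        (fun y => g (∑ l, optionTrace ξ (y l)))| ≤
      (κ + Λ / m) / (1 - Λ / m) *
        (√(wcov (wpi (rareWeight w m) m)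
          (fun y : Fin m → Option Y => f (∑ l, optionTrace ξ (y l)))
          (fun y => f (∑ l, optionTrace ξ (y l)))) *
        √(wcov (wpi (rareWeight w m) m)
          (fun y : Fin m → Option Y => g (∑ l, optionTrace ξ (y l)))
          (fun y => g (∑ l, optionTrace ξ (y l))))) := by
    filter_upwards [tendsto_natCast_atTop_atTop.eventually_gt_atTop Λ, eventually_gt_atTop 0]
      with m hm hm0
    have hm0' : (0 : ℝ) < m := by exact_mod_cast hm0
    have hεm : 0 < 1 - Λ / m := sub_pos.2 ((div_lt_one hm0').2 hm)
    have h1 := maxCorrLE_rareWeight hw hm0' hm (A := optionTrace A) (B := optionTrace B) hκ h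
    have h2 := h1.pi (by positivity) (rareWeight_nonneg hw hm0' hm.le) (sum_rareWeight w m) m
      (fun x => f (∑ l, x l)) (fun x => g (∑ l, x l))
    simp only [hfA, hgB]
    exact h2
  have final := le_of_tendsto_of_tendsto (lim hC hD).abs
    (hρ.mul (((Real.continuous_sqrt.tendsto _).comp (lim hC hC)).mul
      ((Real.continuous_sqrt.tendsto _).comp (lim hD hD)))) bound
  rwa [covariance_self hm_f.aemeasurable, covariance_self hm_g.aemeasurable] at final

/-- The coordinates outside `S` are replaced by `0`. -/
def maskOn {M : ℕ} (S : Finset (Fin (M + 1))) (x : Fin (M + 1) → ℕ) : Fin (M + 1) → ℕ :=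
  fun k => if k ∈ S then x k else 0

lemma maskOn_sum_optionTrace {M m : ℕ} (S : Finset (Fin (M + 1)))
    (y : Fin m → Option (Fin (M + 1) × Fin (M + 1))) :
    maskOn S (∑ l, optionTrace (intervalTrace Finset.univ) (y l)) =
      maskOn S (∑ l, optionTrace (intervalTrace S) (y l)) := by
  funext k
  simp only [maskOn, Finset.sum_apply]
  split_ifs with hk
  · refine Finset.sum_congr rfl fun l _ => ?_
    cases y l <;> simp [optionTrace, intervalTrace, hk]
  · rfl

/-- The correlation bound for bounded functions of the process on a window, which depend on its
values at times in `S`, respectively `T`. -/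
lemma corrLE_window [IsProbabilityMeasure P] {a : unitInterval} {lam : ℝ≥0} {X U V : ℤ → Ω → ℕ}
    (h : IsPoissonINARDecomposition a lam P X U V) (hX : ∀ k, Measurable (X k))
    (hst : IsStrictlyStationary P X) (ha0 : 0 < (a : ℝ)) (ha1 : (a : ℝ) < 1) (k₀ : ℤ) {M n : ℕ}
    {S T : Finset (Fin (M + 1))} (hST : ∀ s ∈ S, ∀ t ∈ T, n ≤ ((s : ℤ) - t).natAbs)
    {f g : (Fin (M + 1) → ℕ) → ℝ} {C D : ℝ} (hC : ∀ x, |f x| ≤ C) (hD : ∀ x, |g x| ≤ D) :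
    CorrLE P (fun ω => f (maskOn S fun k => X (k₀ + (k : ℕ)) ω))
      (fun ω => g (maskOn T fun k => X (k₀ + (k : ℕ)) ω)) (schurConst a n ^ 2) := by
  refine corrLE_of_poisson_superposition (w := particleWeight (a : ℝ) (lam : ℝ))
    (f := fun x => f (maskOn S x)) (g := fun x => g (maskOn T x)) (fun y => ?_)
    (intervalTrace Finset.univ) (intervalTrace S) (intervalTrace T)
    (measurable_pi_lambda _ fun k => hX _) (fun z hz => ?_) (sq_nonneg _) (fun f g hf hg => ?_)
    (fun x => hC _) (fun x => hD _) (fun m y => ?_) (fun m y => ?_)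
  · exact mul_nonneg lam.2 (mul_nonneg (birthWeight_pos ha0 ha1 _).le
      (deathWeight_pos ha0 ha1 _ _).le)
  · -- extend `z` to all indices
    set z' : ℕ → ℂ := fun j => if hj : j < M + 1 then z ⟨j, hj⟩ else 1
    have hz' : ∀ k : Fin (M + 1), z' k = z k := fun k => dif_pos k.2
    have hz'1 : ∀ j, ‖z' j‖ ≤ 1 := fun j => by
      simp only [z']
      split_ifs
      · exact hz _
      · simp
    have hw := integral_prod_pow h hX hst ha0 ha1 k₀ M z' hz'1
    have e := windowExponent_eq_sum_particleWeight a lam M z'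
    simp only [hz'] at e
    rw [← e, ← hw]
    refine integral_congr_ae (ae_of_all _ fun ω => ?_)
    dsimp only
    rw [← Fin.prod_univ_eq_prod_range (fun j => z' j ^ X (k₀ + j) ω)]
    simp only [hz']
  · exact abs_sum_particleWeight_le ha0 ha1 lam.2 hST hf hg
  · rw [maskOn_sum_optionTrace]
  · rw [maskOn_sum_optionTrace]

/-! ### Approximation of square-integrable functions -/

/-- Correlation bounds pass to dominated limits. -/
lemma CorrLE.of_tendsto [IsProbabilityMeasure P] {f g F G : Ω → ℝ} {fs gs : ℕ → Ω → ℝ} {ρ : ℝ}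
    (hf : MemLp f 2 P) (hg : MemLp g 2 P) (hF : MemLp F 2 P) (hG : MemLp G 2 P)
    (hfm : ∀ n, AEStronglyMeasurable (fs n) P) (hgm : ∀ n, AEStronglyMeasurable (gs n) P)
    (hfF : ∀ n, ∀ᵐ ω ∂P, |fs n ω| ≤ F ω) (hgG : ∀ n, ∀ᵐ ω ∂P, |gs n ω| ≤ G ω)
    (hft : ∀ᵐ ω ∂P, Tendsto (fun n => fs n ω) atTop (𝓝 (f ω)))
    (hgt : ∀ᵐ ω ∂P, Tendsto (fun n => gs n ω) atTop (𝓝 (g ω)))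
    (h : ∀ n, CorrLE P (fs n) (gs n) ρ) : CorrLE P f g ρ := by
  have lim : ∀ {u v U V : Ω → ℝ} {us vs : ℕ → Ω → ℝ}, MemLp u 2 P → MemLp v 2 P → MemLp U 2 P →
      MemLp V 2 P → (∀ n, AEStronglyMeasurable (us n) P) → (∀ n, AEStronglyMeasurable (vs n) P) →
      (∀ n, ∀ᵐ ω ∂P, |us n ω| ≤ U ω) → (∀ n, ∀ᵐ ω ∂P, |vs n ω| ≤ V ω) →
      (∀ᵐ ω ∂P, Tendsto (fun n => us n ω) atTop (𝓝 (u ω))) →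
      (∀ᵐ ω ∂P, Tendsto (fun n => vs n ω) atTop (𝓝 (v ω))) →
      Tendsto (fun n => covariance (us n) (vs n) P) atTop (𝓝 (covariance u v P)) := by
    intro u v U V us vs hu hv hU hV hum hvm huU hvV hut hvt
    have hus : ∀ n, MemLp (us n) 2 P := fun n => hU.mono' (hum n) (huU n)
    have hvs : ∀ n, MemLp (vs n) 2 P := fun n => hV.mono' (hvm n) (hvV n)
    rw [covariance_eq_sub hu hv]
    simp_rw [fun n => covariance_eq_sub (hus n) (hvs n)]
    refine Tendsto.sub ?_ (Tendsto.mul ?_ ?_)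
    · refine tendsto_integral_of_dominated_convergence (fun ω => U ω * V ω)
        (fun n => (hum n).mul (hvm n)) (hU.integrable_mul hV) (fun n => ?_) ?_
      · filter_upwards [huU n, hvV n] with ω h₁ h₂
        rw [Pi.mul_apply, Real.norm_eq_abs, abs_mul]
        exact mul_le_mul h₁ h₂ (abs_nonneg _) ((abs_nonneg _).trans h₁)
      · filter_upwards [hut, hvt] with ω h₁ h₂
        exact h₁.mul h₂
    · exact tendsto_integral_of_dominated_convergence U hum (hU.integrable one_le_two) huU hut
    · exact tendsto_integral_of_dominated_convergence V hvm (hV.integrable one_le_two) hvV hvt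
  have key := le_of_tendsto_of_tendsto' (lim hf hg hF hG hfm hgm hfF hgG hft hgt).abs
    (Tendsto.const_mul ρ
      (((Real.continuous_sqrt.tendsto _).comp (lim hf hf hF hF hfm hfm hfF hfF hft hft)).mul
        ((Real.continuous_sqrt.tendsto _).comp (lim hg hg hG hG hgm hgm hgG hgG hgt hgt))))
    fun n => by
      have := h n
      rw [CorrLE, ← covariance_self (hfm n).aemeasurable,
        ← covariance_self (hgm n).aemeasurable] at this
      exact this
  rwa [covariance_self hf.aestronglyMeasurable.aemeasurable,
    covariance_self hg.aestronglyMeasurable.aemeasurable] at key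

/-- Truncation at level `K`. -/
def clip (K x : ℝ) : ℝ := max (-K) (min K x)

lemma abs_clip_le {K : ℝ} (hK : 0 ≤ K) (x : ℝ) : |clip K x| ≤ K := by
  rw [clip, abs_le]
  exact ⟨le_max_left _ _, max_le (by linarith) (min_le_left _ _)⟩

lemma abs_clip_le_abs {K : ℝ} (hK : 0 ≤ K) (x : ℝ) : |clip K x| ≤ |x| := by
  rw [clip, abs_le]
  constructor
  · refine le_max_of_le_right (le_min ?_ (neg_abs_le x))
    linarith [abs_nonneg x]
  · refine max_le ?_ ((min_le_right _ _).trans (le_abs_self x))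
    linarith [abs_nonneg x]

lemma clip_eq_self {K x : ℝ} (h : |x| ≤ K) : clip K x = x := by
  rw [abs_le] at h
  rw [clip, min_eq_right h.2, max_eq_right h.1]

lemma continuous_clip (K : ℝ) : Continuous (clip K) :=
  continuous_const.max (continuous_const.min continuous_id)

/-- The filtration of the values of the process at the times in `S ∩ [-N, N]`. -/
def windowFiltration {X : ℤ → Ω → ℕ} (hX : ∀ k, Measurable (X k)) (S : Set ℤ) :
    Filtration ℕ mΩ where
  seq N := sigmaGen X (S ∩ Set.Icc (-(N : ℤ)) N)
  mono' N N' h := biSup_mono fun k hk => ⟨hk.1, by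
    have := hk.2
    rw [Set.mem_Icc] at this ⊢
    have : (N : ℤ) ≤ N' := by exact_mod_cast h
    constructor <;> omega⟩
  le' N := sigmaGen_le hX _

lemma iSup_windowFiltration {X : ℤ → Ω → ℕ} (hX : ∀ k, Measurable (X k)) (S : Set ℤ) :
    ⨆ N, windowFiltration hX S N = sigmaGen X S := by
  refine le_antisymm (iSup_le fun N => biSup_mono fun k hk => hk.1) (iSup₂_le fun k hk => ?_)
  refine le_trans ?_ (le_iSup (fun N => (windowFiltration hX S N : MeasurableSpace Ω)) k.natAbs)
  refine le_iSup₂ (f := fun k _ => MeasurableSpace.comap (X k) ⊤) k ⟨hk, ?_⟩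
  rw [Set.mem_Icc]
  omega

open scoped Classical in
/-- The set of positions of the window `[-N, N]` which belong to `S`. -/
noncomputable def positions (S : Set ℤ) (N : ℕ) : Finset (Fin (2 * N + 1)) :=
  Finset.univ.filter fun k => -(N : ℤ) + (k : ℕ) ∈ S

lemma mem_positions {S : Set ℤ} {N : ℕ} {k : Fin (2 * N + 1)} :
    k ∈ positions S N ↔ -(N : ℤ) + (k : ℕ) ∈ S := by
  simp [positions]

/-- Functions of the values at the times in `S ∩ [-N, N]` are functions of the masked window. -/
lemma exists_eq_comp_maskOn {X : ℤ → Ω → ℕ} (hX : ∀ k, Measurable (X k)) (S : Set ℤ) (N : ℕ)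
    {f : Ω → ℝ} (hf : StronglyMeasurable[windowFiltration hX S N] f) :
    ∃ φ : (Fin (2 * N + 1) → ℕ) → ℝ,
      f = fun ω => φ (maskOn (positions S N) fun k => X (-(N : ℤ) + (k : ℕ)) ω) := by
  set R : Ω → Fin (2 * N + 1) → ℕ :=
    fun ω => maskOn (positions S N) fun k => X (-(N : ℤ) + (k : ℕ)) ω with hR
  have hle : (windowFiltration hX S N : MeasurableSpace Ω) ≤
      MeasurableSpace.comap R MeasurableSpace.pi := by
    refine iSup₂_le fun k hk => ?_
    have hkN := hk.2
    rw [Set.mem_Icc] at hkN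
    have hlt : (k + N).toNat < 2 * N + 1 := by omega
    have hpos : -(N : ℤ) + (k + N).toNat = k := by omega
    have hXR : X k = fun ω => R ω ⟨(k + N).toNat, hlt⟩ := by
      funext ω
      have : (⟨(k + N).toNat, hlt⟩ : Fin (2 * N + 1)) ∈ positions S N := by
        rw [mem_positions]
        simpa only [hpos] using hk.1
      simp only [hR, maskOn, if_pos this, hpos]
    rw [hXR]
    exact measurable_iff_comap_le.1
      ((measurable_pi_apply (⟨(k + N).toNat, hlt⟩ : Fin (2 * N + 1))).comp (comap_measurable R))
  obtain ⟨φ, -, hφ⟩ := (hf.mono hle).exists_eq_measurable_comp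
  exact ⟨φ, hφ⟩

/-- Bounded functions: approximation by conditional expectations given finite windows. -/
lemma corrLE_of_bounded [IsProbabilityMeasure P] {a : unitInterval} {lam : ℝ≥0} {X U V : ℤ → Ω → ℕ}
    (h : IsPoissonINARDecomposition a lam P X U V) (hX : ∀ k, Measurable (X k))
    (hst : IsStrictlyStationary P X) (ha0 : 0 < (a : ℝ)) (ha1 : (a : ℝ) < 1) {n : ℕ} {S T : Set ℤ}
    (hST : ∀ s ∈ S, ∀ t ∈ T, (n : ℤ) ≤ |s - t|) {f g : Ω → ℝ} (hf : Measurable[sigmaGen X S] f)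
    (hg : Measurable[sigmaGen X T] g) {K : ℝ} (hfK : ∀ ω, |f ω| ≤ K) (hgK : ∀ ω, |g ω| ≤ K)
    (hK : 0 ≤ K) : CorrLE P f g (schurConst a n ^ 2) := by
  have hfm : Measurable f := hf.mono (sigmaGen_le hX S) le_rfl
  have hgm : Measurable g := hg.mono (sigmaGen_le hX T) le_rfl
  have approx : ∀ (R : Set ℤ) (φ : Ω → ℝ), Measurable[sigmaGen X R] φ → (∀ ω, |φ ω| ≤ K) →
      ∀ᵐ ω ∂P, Tendsto (fun N => clip K (P[φ | windowFiltration hX R N] ω)) atTop (𝓝 (φ ω)) := by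
    intro R φ hφ hφK
    have hφm : Measurable φ := hφ.mono (sigmaGen_le hX R) le_rfl
    have hce : P[φ | ⨆ N, windowFiltration hX R N] = φ := by
      rw [iSup_windowFiltration]
      exact condExp_of_stronglyMeasurable (sigmaGen_le hX R) hφ.stronglyMeasurable
        ((memLp_of_abs_le hφm hφK).integrable one_le_two)
    filter_upwards [tendsto_ae_condExp (ℱ := windowFiltration hX R) (μ := P) φ] with ω hω
    rw [hce] at hω
    have := ((continuous_clip K).tendsto _).comp hω
    rwa [clip_eq_self (hφK ω)] at this
  have hcm : ∀ (R : Set ℤ) (φ : Ω → ℝ) (N : ℕ),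
      AEStronglyMeasurable (fun ω => clip K (P[φ | windowFiltration hX R N] ω)) P := fun R φ N =>
    ((continuous_clip K).comp_stronglyMeasurable
      (stronglyMeasurable_condExp.mono ((windowFiltration hX R).le N))).aestronglyMeasurable
  refine CorrLE.of_tendsto (F := fun _ => K) (G := fun _ => K) (memLp_of_abs_le hfm hfK)
    (memLp_of_abs_le hgm hgK) (memLp_const K) (memLp_const K) (hcm S f) (hcm T g)
    (fun N => ae_of_all _ fun ω => abs_clip_le hK _)
    (fun N => ae_of_all _ fun ω => abs_clip_le hK _) (approx S f hf hfK) (approx T g hg hgK)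
    fun N => ?_
  obtain ⟨φ, hφ⟩ := exists_eq_comp_maskOn hX S N
    (stronglyMeasurable_condExp (μ := P) (f := f) (m := windowFiltration hX S N))
  obtain ⟨ψ, hψ⟩ := exists_eq_comp_maskOn hX T N
    (stronglyMeasurable_condExp (μ := P) (f := g) (m := windowFiltration hX T N))
  rw [hφ, hψ]
  refine corrLE_window h hX hst ha0 ha1 (-(N : ℤ)) (f := fun x => clip K (φ x))
    (g := fun x => clip K (ψ x)) (C := K) (D := K) (fun s hs t ht => ?_)
    (fun x => abs_clip_le hK _) (fun x => abs_clip_le hK _)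
  have := hST _ (mem_positions.1 hs) _ (mem_positions.1 ht)
  rw [Int.abs_eq_natAbs] at this
  omega

lemma corrLE_of_memLp [IsProbabilityMeasure P] {a : unitInterval} {lam : ℝ≥0} {X U V : ℤ → Ω → ℕ}
    (h : IsPoissonINARDecomposition a lam P X U V) (hX : ∀ k, Measurable (X k))
    (hst : IsStrictlyStationary P X) (ha0 : 0 < (a : ℝ)) (ha1 : (a : ℝ) < 1) {n : ℕ} {S T : Set ℤ}
    (hST : ∀ s ∈ S, ∀ t ∈ T, (n : ℤ) ≤ |s - t|) {f g : Ω → ℝ} (hf : Measurable[sigmaGen X S] f)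
    (hg : Measurable[sigmaGen X T] g) (hf2 : MemLp f 2 P) (hg2 : MemLp g 2 P) :
    CorrLE P f g (schurConst a n ^ 2) := by
  have ht : ∀ (φ : Ω → ℝ) (ω : Ω), Tendsto (fun N : ℕ => clip N (φ ω)) atTop (𝓝 (φ ω)) := by
    intro φ ω
    refine tendsto_const_nhds.congr' ?_
    filter_upwards [tendsto_natCast_atTop_atTop.eventually_ge_atTop |φ ω|] with N hN
    exact (clip_eq_self hN).symm
  have hm : ∀ {m : MeasurableSpace Ω} {φ : Ω → ℝ} (N : ℕ), Measurable[m] φ →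
      Measurable[m] fun ω => clip N (φ ω) := fun N hφ => (continuous_clip N).measurable.comp hφ
  refine CorrLE.of_tendsto (fs := fun N ω => clip N (f ω)) (gs := fun N ω => clip N (g ω))
    hf2 hg2 hf2.abs hg2.abs
    (fun N => ((hm N hf).mono (sigmaGen_le hX S) le_rfl).aestronglyMeasurable)
    (fun N => ((hm N hg).mono (sigmaGen_le hX T) le_rfl).aestronglyMeasurable)
    (fun N => ae_of_all _ fun ω => abs_clip_le_abs N.cast_nonneg _)
    (fun N => ae_of_all _ fun ω => abs_clip_le_abs N.cast_nonneg _)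
    (ae_of_all _ (ht f)) (ae_of_all _ (ht g)) fun N => ?_
  exact corrLE_of_bounded h hX hst ha0 ha1 hST (hm N hf) (hm N hg)
    (fun ω => abs_clip_le N.cast_nonneg _) (fun ω => abs_clip_le N.cast_nonneg _) N.cast_nonneg

/-! ### Bounds for the dependence coefficient -/

lemma CorrLE.abs_corr_le {f g : Ω → ℝ} {ρ : ℝ} (hρ : 0 ≤ ρ) (h : CorrLE P f g ρ) :
    |corr P f g| ≤ ρ := by
  have hs : 0 ≤ √(variance f P) * √(variance g P) := by positivity
  rw [corr, abs_div, abs_of_nonneg hs]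
  exact div_le_of_le_mul₀ hs hρ h

lemma maxCorr_nonneg (P : Measure Ω) (𝓐 𝓑 : MeasurableSpace Ω) : 0 ≤ maxCorr 𝓐 𝓑 P :=
  Real.sSup_nonneg fun _ ⟨_, _, _, _, _, _, hr⟩ => hr ▸ abs_nonneg _

lemma rhoStar_nonneg (P : Measure Ω) (X : ℤ → Ω → ℕ) (n : ℕ) : 0 ≤ rhoStar P X n :=
  Real.sSup_nonneg fun _ ⟨_, _, _, _, _, _, hr⟩ => hr.symm ▸ maxCorr_nonneg _ _ _

lemma rhoStar_le [IsProbabilityMeasure P] {a : unitInterval} {lam : ℝ≥0} {X : ℤ → Ω → ℕ}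
    (h : IsStationaryPoissonINAR a lam P X) (ha0 : 0 < (a : ℝ)) (ha1 : (a : ℝ) < 1) (n : ℕ) :
    rhoStar P X n ≤ schurConst a n ^ 2 := by
  obtain ⟨U, V, hUV⟩ := h.exists_decomposition
  refine Real.sSup_le ?_ (sq_nonneg _)
  rintro r ⟨S, T, -, -, -, hST, rfl⟩
  refine Real.sSup_le ?_ (sq_nonneg _)
  rintro r ⟨f, g, hf, hf2, hg, hg2, rfl⟩
  exact (corrLE_of_memLp hUV h.measurable_X h.stationary ha0 ha1 hST hf hg hf2 hg2).abs_corr_le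
    (sq_nonneg _)

/-- The bound is geometric in `n`, uniformly in `a ≤ b`. -/
lemma schurConst_sq_le {a b : ℝ} (ha0 : 0 < a) (hab : a ≤ b) (hb : b < 1) (n : ℕ) :
    schurConst a n ^ 2 ≤ (2 / ((1 - b) * (1 - √b))) ^ 2 * b ^ n := by
  have hb0 : 0 < b := ha0.trans_le hab
  have h1 := sub_pos.2 hb
  have h2 : 0 < 1 - √b := by
    rw [sub_pos, Real.sqrt_lt' one_pos]; simpa using hb
  have hs : √a ≤ √b := Real.sqrt_le_sqrt hab
  have key : schurConst a n ≤ 2 / ((1 - b) * (1 - √b)) * √b ^ n := by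
    calc schurConst a n ≤ (1 - b)⁻¹ * (2 * √b ^ n / (1 - √b)) := by
          have h3 : 0 ≤ 2 * √a ^ n / (1 - √a) :=
            div_nonneg (by positivity) (h2.le.trans (by linarith))
          rw [schurConst]
          gcongr
      _ = _ := by field_simp
  calc schurConst a n ^ 2 ≤ (2 / ((1 - b) * (1 - √b)) * √b ^ n) ^ 2 :=
        pow_le_pow_left₀ (schurConst_nonneg (hab.trans_lt hb) n) key 2
    _ = _ := by rw [mul_pow, ← pow_mul, mul_comm n, pow_mul, Real.sq_sqrt hb0.le]

end INARMixing

theorem theorem1p3 (b : ℝ) (hb0 : 0 < b) (hb1 : b < 1) :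
    ∃ C r : ℝ, 0 < C ∧ 0 < r ∧ r < 1 ∧
      ∀ (a : unitInterval) (lam : ℝ≥0), 0 < (a : ℝ) → (a : ℝ) ≤ b → 0 < lam →
        ∀ (Ω : Type*) [MeasurableSpace Ω] (P : Measure Ω) [IsProbabilityMeasure P]
          (X : ℤ → Ω → ℕ), INARMixing.IsStationaryPoissonINAR a lam P X →
            INARMixing.IsRhoStarMixing P X ∧
              ∀ n : ℕ, 1 ≤ n → INARMixing.rhoStar P X n ≤ C * r ^ n := by
  have h1 := sub_pos.2 hb1
  have h2 : 0 < 1 - √b := by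
    rw [sub_pos, Real.sqrt_lt' one_pos]; simpa using hb1
  refine ⟨(2 / ((1 - b) * (1 - √b))) ^ 2, b, by positivity, hb0, hb1, ?_⟩
  intro a lam ha0 hab _ Ω _ P _ X h
  have hle : ∀ n, INARMixing.rhoStar P X n ≤ (2 / ((1 - b) * (1 - √b))) ^ 2 * b ^ n := fun n =>
    (INARMixing.rhoStar_le h ha0 (hab.trans_lt hb1) n).trans
      (INARMixing.schurConst_sq_le ha0 hab hb1 n)
  refine ⟨?_, fun n _ => hle n⟩
  refine squeeze_zero (fun n => INARMixing.rhoStar_nonneg P X n) hle ?_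
  simpa using (tendsto_pow_atTop_nhds_zero_of_lt_one hb0.le hb1).const_mul
    ((2 / ((1 - b) * (1 - √b))) ^ 2)
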